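/- Let $X=(X_t)_{t\in\mathbb Z}$ be a stationary sequence of real random variables, all of whose moments are finite ($\mathbb E|X_0|^p<\infty$ for every $p\in\mathbb N$; for instance, bounded or Gaussian). For $a\ge 1$ let $$\beta(a)=\sup_{C}\bigl|\bigl(\mathbb P_{-\infty}^{t}\otimes\mathbb P_{t+a}^{\infty}\bigr)(C)-\mathbb P_{t,a}(C)\bigr| ,$$ where $C$ runs over the measurable sets, $\mathbb P_{-\infty}^{t}$ and $\mathbb P_{t+a}^{\infty}$ are the laws of $(X_s)_{s\le t}$ and $(X_s)_{s\ge t+a}$, and $\mathbb P_{t,a}$ is their joint law; by stationarity this does not depend on $t\in\mathbb Z$. Suppose that $X$ is $\beta$-mixing, i.e. $\beta(a)\to 0$ as $a\to\infty$, with no assumption on the rate. Given the sample $X_1,\dots,X_n$ and a bandwidth $h>0$, let $\widehat f^{d}$ be the histogram, on the grid of cubes $\prod_k[z_kh,(z_k+1)h)$, $z\in\mathbb Z^{d}$, of the $n-d+1$ vectors $(X_i,\dots,X_{i+d-1})$ contained in the sample, let $\widehat f^{2d}_a$ be the histogram, on the analogous grid of $\mathbb R^{2d}$, of the $n-2d-a+2$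 vectors $(X_i,\dots,X_{i+d-1},X_{i+d-1+a},\dots,X_{i+2d+a-2})$ contained in the sample (a histogram of $N$ points in $\mathbb R^D$ takes at $x$ the value $\#\{\text{points in the bin of }x\}/(Nh^{D})$), and let $$\widehat\beta^{d}(a)=\frac12\int\bigl|\widehat f_a^{2d}-\widehat f^{d}\otimes\widehat f^{d}\bigr| .$$ Let $d_n$ be natural numbers with $d_n\to\infty$ and $d_n=O(\exp\{W(\log n)\})$, where $W$ is the principal branch of the Lambert function, the inverse of $w\mapsto we^{w}$. Then: 1. there are bandwidths $h_n>0$ with $h_n\to0$ and $n^{\gamma}h_n^{2d_n}\to\infty$ for some $\gamma<1$; 2. for every such sequence $(h_n)$ and every $a\ge1$, the estimator $\widehat\beta^{d_n}(a)$ with bandwidth $h_n$ converges in probability to $\beta(a)$ as $n\to\infty$. -/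

import Mathlib

open MeasureTheory Filter Topology Asymptotics

noncomputable section

namespace BetaMixing

/-- Principal real branch of the Lambert `W` function: for `x ≥ -1/e`, the unique `w ≥ -1` with
`w * exp w = x`. -/
def lambertW : ℝ → ℝ :=
  Function.invFunOn (fun w : ℝ => w * Real.exp w) (Set.Ici (-1))

/-- Total variation distance `sup_C |μ(C) - ν(C)|` over measurable sets `C`. -/
def tvDist {S : Type*} [MeasurableSpace S] (μ ν : Measure S) : ℝ :=
  sSup {r : ℝ | ∃ C : Set S, MeasurableSet C ∧ r = |μ.real C - ν.real C|}

section Coefficients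

variable {Ω : Type*} [MeasurableSpace Ω]

/-- The past `(X_t, X_{t-1}, X_{t-2}, …)`. -/
def past (X : ℤ → Ω → ℝ) (t : ℤ) (ω : Ω) : ℕ → ℝ := fun k => X (t - k) ω

/-- The future `(X_t, X_{t+1}, X_{t+2}, …)`. -/
def future (X : ℤ → Ω → ℝ) (t : ℤ) (ω : Ω) : ℕ → ℝ := fun k => X (t + k) ω

/-- The coefficient of absolute regularity at lag `a`, computed at time `t`: the total variation
distance between the product of the laws of `X_{-∞}^t` and `X_{t+a}^∞` and their joint law. -/
def betaCoef (P : Measure Ω) (X : ℤ → Ω → ℝ) (t : ℤ) (a : ℕ) : ℝ :=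
  tvDist ((P.map (past X t)).prod (P.map (future X (t + a))))
    (P.map fun ω => (past X t ω, future X (t + a) ω))

/-- Absolute regularity (`β`-mixing). -/
def IsBetaMixing (P : Measure Ω) (X : ℤ → Ω → ℝ) : Prop :=
  ∀ t : ℤ, Tendsto (fun a : ℕ => betaCoef P X t a) atTop (𝓝 0)

/-- Stationarity: `(X_t, …, X_{t+i})` and `(X_{t+j}, …, X_{t+j+i})` have the same law. -/
def IsStationary (P : Measure Ω) (X : ℤ → Ω → ℝ) : Prop :=
  ∀ (t : ℤ) (i j : ℕ),
    P.map (fun ω => fun k : Fin (i + 1) => X (t + (k : ℕ)) ω) =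
      P.map (fun ω => fun k : Fin (i + 1) => X (t + j + (k : ℕ)) ω)

end Coefficients

open Classical in
/-- Histogram density estimate on `ℝ^ι` from the points `y 0, …, y (N - 1)`, on the grid of cubes
`∏ₖ [zₖ h, (zₖ + 1) h)`, `z ∈ ℤ^ι`: the number of points in the bin of `x`, divided by
`N h^|ι|`. -/
def histogram {ι : Type*} [Fintype ι] (h : ℝ) (N : ℕ) (y : ℕ → ι → ℝ) (x : ι → ℝ) : ℝ :=
  (((Finset.range N).filter fun i => ∀ k, ⌊y i k / h⌋ = ⌊x k / h⌋).card : ℝ) /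
    (N * h ^ Fintype.card ι)

/-- Histogram estimate, from the sample `x_1, …, x_n`, of the joint density of `d` consecutive
observations. All `n - d + 1` windows of the sample are used. -/
def fHat (x : ℤ → ℝ) (n d : ℕ) (h : ℝ) : (Fin d → ℝ) → ℝ :=
  histogram h (n + 1 - d) fun i k => x (i + 1 + (k : ℕ))

/-- Histogram estimate, from the sample `x_1, …, x_n`, of the joint density of two blocks of `d`
consecutive observations separated by `a - 1` time points, i.e. of
`(X_{s-d+1}, …, X_s)` and `(X_{s+a}, …, X_{s+a+d-1})`. All `n - 2d - a + 2` windows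
of the sample are used. -/
def fHatPair (x : ℤ → ℝ) (n d a : ℕ) (h : ℝ) : (Fin d ⊕ Fin d → ℝ) → ℝ :=
  histogram h (n + 2 - (2 * d + a)) fun i =>
    Sum.elim (fun k => x (i + 1 + (k : ℕ))) (fun k => x (i + d + a + (k : ℕ)))

/-- The estimator `½ ∫ |f̂_a^{2d} - f̂^d ⊗ f̂^d|` from the sample `x_1, …, x_n`. -/
def betaHat (x : ℤ → ℝ) (n d a : ℕ) (h : ℝ) : ℝ :=
  (1 / 2) * ∫ p : (Fin d → ℝ) × (Fin d → ℝ),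
    |fHatPair x n d a h (Sum.elim p.1 p.2) - fHat x n d h p.1 * fHat x n d h p.2|

/-- Bandwidths `h_n → 0` for which the expected count per bin of the `2 d_n`-dimensional grid is
large: `μ_n h_n^{2 d_n} → ∞` with `μ_n = n^γ` for some `γ < 1`. -/
structure IsAdmissibleBandwidth (d : ℕ → ℕ) (h : ℕ → ℝ) : Prop where
  pos : ∀ n, 0 < h n
  tendsto_zero : Tendsto h atTop (𝓝 0)
  bin_count : ∃ γ : ℝ, γ < 1 ∧ Tendsto (fun n : ℕ => (n : ℝ) ^ γ * h n ^ (2 * d n)) atTop atTop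

end BetaMixing

end

namespace BetaMixing

/-! ### Total variation distance -/

section TotalVariation

variable {S : Type*} [MeasurableSpace S]

/-! Cell volumes cancel the histogram normalisation, so the estimator is half the ℓ¹ distance
between the empirical frequencies of pairs of cells and products of empirical block frequencies
(`betaHat_eq_tsum`). With true cell probabilities instead, the same sum is the total variation
distance between the product law and the joint law after binning (`half_tsum_eq_tvDist_gridMap`).
Densities never enter.

Bias. The grids need not be nested. Still, the sets that can be approximated by unions of cells form
a σ-algebra, and it contains every coordinate because `d n → ∞` and `h n → 0`. Hence the binned
distance tends to `β(a)` (`tendsto_tvDist_gridMap`).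

Fluctuation (`integral_sum_abs_freq_sub_le`). A cell indicator minus its probability is an
innovation with respect to the past at gap `g`, plus a conditional probability minus the
probability. Summed over any number of cells, the second part costs at most `2β(g)` in mean.
Innovations are orthogonal beyond window length plus gap, so by Cauchy–Schwarz over the cells their
averages cost the root of (length + gap) · (number of cells) / (sample size), up to a constant. The
gap is fixed first, then `n → ∞`, so no mixing rate is needed.

Truncation. Only cells meeting `[-R, R]^d` with `R = d ^ ε` are counted; finite moments make the
rest negligible. The Lambert condition gives `d log d = O(log n)`, so `R ^ (2d)` is a small power of
`n`, which fits into the room left by `γ < 1`. -/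

lemma bddAbove_tvDist (μ ν : Measure S) [IsProbabilityMeasure μ] [IsProbabilityMeasure ν] :
    BddAbove {r : ℝ | ∃ C : Set S, MeasurableSet C ∧ r = |μ.real C - ν.real C|} := by
  refine ⟨1, ?_⟩
  rintro r ⟨C, -, rfl⟩
  rw [abs_le]
  constructor <;> linarith [measureReal_nonneg (μ := μ) (s := C), measureReal_nonneg (μ := ν) (s := C),
    measureReal_le_one (μ := μ) (s := C), measureReal_le_one (μ := ν) (s := C)]

lemma abs_sub_le_tvDist (μ ν : Measure S) [IsProbabilityMeasure μ] [IsProbabilityMeasure ν]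
    {C : Set S} (hC : MeasurableSet C) : |μ.real C - ν.real C| ≤ tvDist μ ν :=
  le_csSup (bddAbove_tvDist μ ν) ⟨C, hC, rfl⟩

lemma tvDist_le {μ ν : Measure S} {r : ℝ}
    (h : ∀ C, MeasurableSet C → |μ.real C - ν.real C| ≤ r) : tvDist μ ν ≤ r := by
  refine csSup_le ⟨_, ∅, MeasurableSet.empty, rfl⟩ ?_
  rintro _ ⟨C, hC, rfl⟩
  exact h C hC

lemma exists_lt_abs_sub {μ ν : Measure S} {r : ℝ} (h : r < tvDist μ ν) :
    ∃ C, MeasurableSet C ∧ r < |μ.real C - ν.real C| := by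
  by_contra! hc
  exact absurd (tvDist_le hc) (not_le.2 h)

lemma hasSum_indicator_real [Countable S] [MeasurableSingletonClass S]
    (μ : Measure S) [IsFiniteMeasure μ] (A : Set S) :
    HasSum (A.indicator fun s => μ.real {s}) (μ.real A) := by
  have hA : MeasurableSet A := A.to_countable.measurableSet
  have h1 : μ A = ∑' s : S, A.indicator (fun s => μ {s}) s := by
    rw [← tsum_subtype, ← measure_biUnion A.to_countable]
    · simp
    · intro x _ y _ hxy
      simpa using hxy
    · intro s _
      exact measurableSet_singleton s
  have h2 : ∑' s : S, A.indicator (fun s => μ {s}) s ≠ ⊤ := by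
    rw [← h1]; exact measure_ne_top _ _
  have h3 := ENNReal.hasSum_toReal h2
  rw [← ENNReal.tsum_toReal_eq (ENNReal.ne_top_of_tsum_ne_top h2), ← h1] at *
  convert h3 using 1
  · ext s
    by_cases hs : s ∈ A <;> simp [hs, Measure.real]
  · rfl

/-- The difference `f` of the point masses has total sum zero, so twice its sum over `A` is the sum
of `±f`, with sign `+` exactly on `A`. This is at most `∑ |f|`, with equality for `A = {f ≥ 0}`. -/
lemma half_tsum_abs_eq_tvDist [Countable S] [MeasurableSingletonClass S]
    (μ ν : Measure S) [IsProbabilityMeasure μ] [IsProbabilityMeasure ν] :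
    (1 / 2) * ∑' s, |μ.real {s} - ν.real {s}| = tvDist μ ν := by
  set f : S → ℝ := fun s => μ.real {s} - ν.real {s} with hf
  have key : ∀ A : Set S, HasSum (A.indicator f) (μ.real A - ν.real A) := by
    intro A
    have hfA : A.indicator f = fun s => A.indicator (fun s => μ.real {s}) s -
        A.indicator (fun s => ν.real {s}) s := by
      funext s
      by_cases hs : s ∈ A <;> simp [hs, hf]
    rw [hfA]
    exact (hasSum_indicator_real μ A).sub (hasSum_indicator_real ν A)
  have h0 : HasSum f 0 := by simpa using key Set.univ
  have h2 : ∀ A : Set S, HasSum (fun s => 2 * A.indicator f s - f s)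
      (2 * (μ.real A - ν.real A)) := by
    intro A
    simpa using ((key A).mul_left 2).sub h0
  have habs : ∀ (A : Set S) (s : S), |2 * A.indicator f s - f s| = |f s| := by
    intro A s
    by_cases hs : s ∈ A
    · simp only [hs, Set.indicator_of_mem]; congr 1; ring
    · simp [hs]
  apply le_antisymm
  · have hA : (fun s => 2 * {s | 0 ≤ f s}.indicator f s - f s) = fun s => |f s| := by
      ext s
      by_cases hs : 0 ≤ f s
      · simp [Set.indicator, hs, abs_of_nonneg]; ring
      · simp [Set.indicator, hs, abs_of_neg (not_le.1 hs)]
    have h3 := h2 {s | 0 ≤ f s}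
    rw [hA] at h3
    rw [h3.tsum_eq]
    have := abs_sub_le_tvDist μ ν (C := {s | 0 ≤ f s}) (Set.to_countable _).measurableSet
    linarith [le_abs_self (μ.real {s | 0 ≤ f s} - ν.real {s | 0 ≤ f s})]
  · refine tvDist_le fun A _ => ?_
    have h3 := h2 A
    have h4 : Summable fun s => |2 * A.indicator f s - f s| := h3.summable.abs
    have h5 : |∑' s, (2 * A.indicator f s - f s)| ≤ ∑' s, |2 * A.indicator f s - f s| := by
      simpa [Real.norm_eq_abs] using
        norm_tsum_le_tsum_norm (f := fun s => 2 * A.indicator f s - f s)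
          (by simpa [Real.norm_eq_abs] using h4)
    rw [h3.tsum_eq] at h5
    simp only [habs] at h5
    rw [abs_mul, abs_two] at h5
    linarith

end TotalVariation

/-! ### Shift invariance of laws and of the mixing coefficient -/

section Stationary

variable {Ω : Type*} [MeasurableSpace Ω] {P : Measure Ω} {X : ℤ → Ω → ℝ}

lemma measurable_past (hX : ∀ s, Measurable (X s)) (t : ℤ) : Measurable (past X t) :=
  measurable_pi_lambda _ fun _ => hX _

lemma measurable_future (hX : ∀ s, Measurable (X s)) (t : ℤ) : Measurable (future X t) :=
  measurable_pi_lambda _ fun _ => hX _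

/-- The law of the whole process is shift-invariant. -/
lemma IsStationary.map_shift [IsProbabilityMeasure P] (hX : ∀ s, Measurable (X s))
    (hstat : IsStationary P X) (s t : ℤ) :
    P.map (fun ω (k : ℤ) => X (s + k) ω) = P.map (fun ω (k : ℤ) => X (t + k) ω) := by
  have hm : ∀ t : ℤ, Measurable (fun ω (k : ℤ) => X (t + k) ω) :=
    fun t => measurable_pi_lambda _ fun _ => hX _
  wlog hst : s ≤ t generalizing s t
  · exact (this t s (by omega)).symm
  obtain ⟨j, rfl⟩ : ∃ j : ℕ, t = s + j := ⟨(t - s).toNat, by omega⟩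
  have hproj : ∀ t : ℤ, IsProjectiveLimit (P.map (fun ω (k : ℤ) => X (t + k) ω))
      (fun I : Finset ℤ => (P.map (fun ω (k : ℤ) => X (t + k) ω)).map I.restrict) :=
    fun t I => rfl
  have hp : ∀ t : ℤ, IsProbabilityMeasure (P.map (fun ω (k : ℤ) => X (t + k) ω)) :=
    fun t => Measure.isProbabilityMeasure_map (hm t).aemeasurable
  have hI : (fun I : Finset ℤ => (P.map (fun ω (k : ℤ) => X (s + k) ω)).map I.restrict) =
      fun I : Finset ℤ => (P.map (fun ω (k : ℤ) => X (s + j + k) ω)).map I.restrict := by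
    funext I
    -- A finite index set lies in `[-m, m]`, so its marginal is an image of the law of a window of
    -- `2 * m + 1` consecutive variables, to which stationarity applies.
    obtain ⟨m, hmI⟩ : ∃ m : ℕ, ∀ k ∈ I, k.natAbs ≤ m :=
      ⟨I.sup Int.natAbs, fun k hk => Finset.le_sup (f := Int.natAbs) hk⟩
    have hsel : ∀ k : I, (k.1 + m).toNat < 2 * m + 1 := fun k => by
      have := hmI k.1 k.2
      omega
    have hR : Measurable (I.restrict (π := fun _ : ℤ => ℝ)) := Finset.measurable_restrict _
    let φ : (Fin (2 * m + 1) → ℝ) → (I → ℝ) := fun v k => v ⟨(k.1 + m).toNat, hsel k⟩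
    have hφ : Measurable φ := measurable_pi_lambda _ fun k => measurable_pi_apply _
    have hw : ∀ t : ℤ, Measurable (fun ω => fun k : Fin (2 * m + 1) => X (t + (k : ℕ)) ω) :=
      fun t => measurable_pi_lambda _ fun _ => hX _
    have h1 : ∀ t : ℤ, (P.map (fun ω (k : ℤ) => X (t + k) ω)).map I.restrict =
        (P.map (fun ω => fun k : Fin (2 * m + 1) => X (t - m + (k : ℕ)) ω)).map φ := by
      intro t
      rw [Measure.map_map hR (hm t), Measure.map_map hφ (hw _)]
      congr 1
      ext ω k
      simp only [Function.comp, Finset.restrict, φ]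
      have := hmI k.1 k.2
      congr 1
      omega
    rw [h1, h1, hstat (s - m) (2 * m) j]
    congr 4
    ext k
    congr 1
    ring
  have h := hproj s
  rw [hI] at h
  have := hp
  exact IsProjectiveLimit.unique h (hproj (s + j))

lemma IsStationary.map_comp_shift [IsProbabilityMeasure P] (hX : ∀ s, Measurable (X s))
    (hstat : IsStationary P X) {T : Type*} [MeasurableSpace T] {φ : (ℤ → ℝ) → T}
    (hφ : Measurable φ) (s t : ℤ) :
    P.map (fun ω => φ fun k => X (s + k) ω) = P.map (fun ω => φ fun k => X (t + k) ω) := by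
  have hm : ∀ t : ℤ, Measurable (fun ω (k : ℤ) => X (t + k) ω) :=
    fun t => measurable_pi_lambda _ fun _ => hX _
  have h := congrArg (Measure.map φ) (hstat.map_shift hX s t)
  rwa [Measure.map_map hφ (hm s), Measure.map_map hφ (hm t)] at h

lemma IsStationary.map_past [IsProbabilityMeasure P] (hX : ∀ s, Measurable (X s))
    (hstat : IsStationary P X) (s t : ℤ) : P.map (past X s) = P.map (past X t) := by
  have hφ : Measurable fun (x : ℤ → ℝ) (k : ℕ) => x (-(k : ℤ)) :=
    measurable_pi_lambda _ fun _ => measurable_pi_apply _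
  exact hstat.map_comp_shift hX hφ s t

lemma IsStationary.map_future [IsProbabilityMeasure P] (hX : ∀ s, Measurable (X s))
    (hstat : IsStationary P X) (s t : ℤ) : P.map (future X s) = P.map (future X t) := by
  have hφ : Measurable fun (x : ℤ → ℝ) (k : ℕ) => x (k : ℤ) :=
    measurable_pi_lambda _ fun _ => measurable_pi_apply _
  exact hstat.map_comp_shift hX hφ s t

lemma IsStationary.betaCoef_eq [IsProbabilityMeasure P] (hX : ∀ s, Measurable (X s))
    (hstat : IsStationary P X) (s t : ℤ) (a : ℕ) : betaCoef P X s a = betaCoef P X t a := by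
  have hφ : Measurable fun (x : ℤ → ℝ) =>
      ((fun k : ℕ => x (-(k : ℤ)), fun k : ℕ => x (a + (k : ℤ))) : (ℕ → ℝ) × (ℕ → ℝ)) :=
    (measurable_pi_lambda _ fun _ => measurable_pi_apply _).prodMk
      (measurable_pi_lambda _ fun _ => measurable_pi_apply _)
  have h := hstat.map_comp_shift hX hφ s t
  have hj : ∀ t : ℤ, (fun ω => (past X t ω, future X (t + a) ω)) = fun ω =>
      ((fun k : ℕ => X (t + -(k : ℤ)) ω, fun k : ℕ => X (t + (a + (k : ℤ))) ω) :
        (ℕ → ℝ) × (ℕ → ℝ)) := by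
    intro t
    ext ω k
    · rfl
    · simp [future, add_assoc]
  unfold betaCoef
  rw [hj, hj, h, hstat.map_past hX s t, hstat.map_future hX (s + a) (t + a)]

end Stationary

/-! ### Mixing bounds for families of past and future events -/

section Concentration

variable {Ω : Type*} {X : ℤ → Ω → ℝ}

/-- The `σ`-algebra generated by `X_t, X_{t-1}, …`. -/
abbrev pastSigma (X : ℤ → Ω → ℝ) (t : ℤ) : MeasurableSpace Ω :=
  MeasurableSpace.comap (past X t) inferInstance

lemma measurable_pastSigma {s t : ℤ} (hst : s ≤ t) : Measurable[pastSigma X t] (X s) := by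
  have h : X s = (fun x : ℕ → ℝ => x (t - s).toNat) ∘ past X t := by
    ext ω
    simp only [Function.comp, past]
    congr 1
    omega
  rw [h]
  exact (measurable_pi_apply _).comp (comap_measurable _)

lemma pastSigma_mono : Monotone (pastSigma X) := by
  intro s t hst
  refine Measurable.comap_le ?_
  exact @measurable_pi_lambda _ _ _ (pastSigma X t) _ _ fun k => measurable_pastSigma (by omega)

variable [mΩ : MeasurableSpace Ω] {P : Measure Ω}

lemma pastSigma_le (hX : ∀ s, Measurable (X s)) (t : ℤ) : pastSigma X t ≤ mΩ :=
  (measurable_past hX t).comap_le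

/-- Disjointness of the future events alone makes the rectangles `A b ×ˢ G b` disjoint, so their
union is a single test set for the total variation. The past events are arbitrary. -/
lemma abs_sum_sub_le_betaCoef [IsProbabilityMeasure P] (hX : ∀ s, Measurable (X s)) (t : ℤ)
    (g : ℕ) {S : Type*} (B : Finset S) {A G : S → Set (ℕ → ℝ)}
    (hA : ∀ b, MeasurableSet (A b)) (hG : ∀ b, MeasurableSet (G b))
    (hdisj : Pairwise fun b c => Disjoint (G b) (G c)) :
    |∑ b ∈ B, (P.real (past X t ⁻¹' A b ∩ future X (t + g) ⁻¹' G b) -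
      P.real (past X t ⁻¹' A b) * P.real (future X (t + g) ⁻¹' G b))| ≤ betaCoef P X t g := by
  have hp := measurable_past hX t
  have hf := measurable_future hX (t + g)
  have := Measure.isProbabilityMeasure_map (μ := P) hp.aemeasurable
  have := Measure.isProbabilityMeasure_map (μ := P) hf.aemeasurable
  have := Measure.isProbabilityMeasure_map (μ := P) (hp.prodMk hf).aemeasurable
  have hm : ∀ b, MeasurableSet (A b ×ˢ G b) := fun b => (hA b).prod (hG b)
  have hd : (B : Set S).PairwiseDisjoint fun b => A b ×ˢ G b := by
    intro b _ c _ hbc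
    exact Set.disjoint_prod.2 (Or.inr (hdisj hbc))
  have hC : MeasurableSet (⋃ b ∈ B, A b ×ˢ G b) := Finset.measurableSet_biUnion B fun b _ => hm b
  have h := abs_sub_le_tvDist ((P.map (past X t)).prod (P.map (future X (t + g))))
    (P.map fun ω => (past X t ω, future X (t + g) ω)) hC
  rw [measureReal_biUnion_finset hd fun b _ => hm b,
    measureReal_biUnion_finset hd fun b _ => hm b, abs_sub_comm, ← Finset.sum_sub_distrib] at h
  refine le_of_eq_of_le (congrArg _ (Finset.sum_congr rfl fun b _ => ?_)) h
  rw [measureReal_prod_prod, map_measureReal_apply hp (hA b), map_measureReal_apply hf (hG b),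
    map_measureReal_apply (hp.prodMk hf) (hm b)]
  rfl

end Concentration

/-! ### Conditional probabilities and innovations -/

section Concentration

variable {Ω : Type*} {m m' : MeasurableSpace Ω} [mΩ : MeasurableSpace Ω] {P : Measure Ω} {X : ℤ → Ω → ℝ}

/-- Splitting at the `m`-measurable set where the conditional probability is at least `p` removes
the absolute value. On each piece the conditional probability integrates like the indicator of `E`.
-/
lemma integral_abs_condExp_indicator_sub [IsProbabilityMeasure P]
    (hm : m ≤ mΩ) {E : Set Ω} (hE : MeasurableSet E) (p : ℝ) :
    ∃ A, MeasurableSet[m] A ∧ ∫ ω, |P[E.indicator (1 : Ω → ℝ) | m] ω - p| ∂P =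
      (P.real (A ∩ E) - P.real A * p) - (P.real (Aᶜ ∩ E) - P.real Aᶜ * p) := by
  set c := P[E.indicator (1 : Ω → ℝ) | m] with hc
  have hcm : Measurable[m] c := stronglyMeasurable_condExp.measurable
  have hci : Integrable c P := integrable_condExp
  have hei : Integrable (E.indicator (1 : Ω → ℝ)) P := (integrable_const (1 : ℝ)).indicator hE
  refine ⟨{ω | p ≤ c ω}, hcm measurableSet_Ici, ?_⟩
  have hA : MeasurableSet[m] {ω | p ≤ c ω} := hcm measurableSet_Ici
  set A := {ω | p ≤ c ω} with hAdef
  have hset : ∀ B : Set Ω, MeasurableSet[m] B →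
      ∫ ω in B, (c ω - p) ∂P = P.real (B ∩ E) - P.real B * p := by
    intro B hB
    rw [integral_sub hci.integrableOn (integrable_const _).integrableOn, hc,
      setIntegral_condExp hm hei hB, integral_indicator_one hE, setIntegral_const, smul_eq_mul,
      measureReal_restrict_apply hE, Set.inter_comm]
  have hi : Integrable (fun ω => |c ω - p|) P := (hci.sub (integrable_const p)).abs
  rw [← integral_add_compl (hm _ hA) hi, ← hset A hA, ← hset Aᶜ hA.compl, sub_eq_add_neg,
    ← integral_neg]
  congr 1
  · refine setIntegral_congr_fun (hm _ hA) fun ω hω => ?_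
    exact abs_of_nonneg (sub_nonneg.2 hω)
  · refine setIntegral_congr_fun (hm _ hA).compl fun ω hω => ?_
    exact abs_of_neg (sub_neg.2 (not_le.1 hω))

/-- Each cell brings its own past event, which `abs_sum_sub_le_betaCoef` permits. The factor 2
counts these events and their complements; the number of cells does not enter. -/
lemma sum_integral_abs_condExp_sub_le [IsProbabilityMeasure P] (hX : ∀ s, Measurable (X s))
    (t : ℤ) (g : ℕ) {S : Type*} (B : Finset S) {G : S → Set (ℕ → ℝ)}
    (hG : ∀ b, MeasurableSet (G b)) (hdisj : Pairwise fun b c => Disjoint (G b) (G c)) :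
    ∑ b ∈ B, ∫ ω, |P[(future X (t + g) ⁻¹' G b).indicator (1 : Ω → ℝ) | pastSigma X t] ω -
      P.real (future X (t + g) ⁻¹' G b)| ∂P ≤ 2 * betaCoef P X t g := by
  have hf := measurable_future hX (t + g)
  choose A hA hAeq using fun b => integral_abs_condExp_indicator_sub (P := P) (pastSigma_le hX t)
    (hf (hG b)) (P.real (future X (t + g) ⁻¹' G b))
  choose A' hA' hAA' using hA
  have h1 := abs_sum_sub_le_betaCoef (P := P) hX t g B hA' hG hdisj
  have h2 := abs_sum_sub_le_betaCoef (P := P) hX t g B (fun b => (hA' b).compl) hG hdisj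
  simp only [Set.preimage_compl, hAA'] at h1 h2
  simp only [hAeq]
  rw [Finset.sum_sub_distrib]
  linarith [(abs_le.1 h1).2, (abs_le.1 h2).1]

lemma condExp_indicator_mem_Icc [IsProbabilityMeasure P]
    (hm : m ≤ mΩ) {E : Set Ω} (hE : MeasurableSet E) :
    ∀ᵐ ω ∂P, P[E.indicator (1 : Ω → ℝ) | m] ω ∈ Set.Icc (0 : ℝ) 1 := by
  have hei : Integrable (E.indicator (1 : Ω → ℝ)) P := (integrable_const (1 : ℝ)).indicator hE
  have h0 : (0 : Ω → ℝ) ≤ᵐ[P] P[E.indicator (1 : Ω → ℝ) | m] :=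
    condExp_nonneg (Eventually.of_forall fun ω => Set.indicator_nonneg (fun _ _ => zero_le_one) ω)
  have h1 : P[E.indicator (1 : Ω → ℝ) | m] ≤ᵐ[P] P[fun _ => (1 : ℝ) | m] :=
    condExp_mono hei (integrable_const _)
      (Eventually.of_forall fun ω => Set.indicator_le_self' (fun _ _ => zero_le_one) ω)
  rw [condExp_const hm] at h1
  filter_upwards [h0, h1] with ω h h' using ⟨h, h'⟩

/-- The indicator of an event minus its conditional probability. -/
noncomputable def innovation (P : Measure Ω) (m : MeasurableSpace Ω) (E : Set Ω) : Ω → ℝ :=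
  E.indicator (1 : Ω → ℝ) - P[E.indicator (1 : Ω → ℝ) | m]

lemma abs_innovation_le_one [IsProbabilityMeasure P]
    (hm : m ≤ mΩ) {E : Set Ω} (hE : MeasurableSet E) :
    ∀ᵐ ω ∂P, |innovation P m E ω| ≤ 1 := by
  filter_upwards [condExp_indicator_mem_Icc (P := P) hm hE] with ω h
  have h1 : E.indicator (1 : Ω → ℝ) ω ∈ Set.Icc (0 : ℝ) 1 := by
    by_cases hω : ω ∈ E <;> simp [hω]
  simp only [innovation, Pi.sub_apply]
  rw [abs_le]
  constructor <;> linarith [h.1, h.2, h1.1, h1.2]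

lemma integrable_innovation [IsProbabilityMeasure P]
    {E : Set Ω} (hE : MeasurableSet E) : Integrable (innovation P m E) P :=
  ((integrable_const (1 : ℝ)).indicator hE).sub integrable_condExp

/-- Proportionality to the probability of `E` is what later allows Cauchy–Schwarz over cells whose
probabilities sum to at most 1. -/
lemma integral_abs_innovation_le [IsProbabilityMeasure P]
    (hm : m ≤ mΩ) {E : Set Ω} (hE : MeasurableSet E) :
    ∫ ω, |innovation P m E ω| ∂P ≤ 2 * P.real E := by
  have hei : Integrable (E.indicator (1 : Ω → ℝ)) P := (integrable_const (1 : ℝ)).indicator hE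
  have h : ∫ ω, |innovation P m E ω| ∂P ≤
      ∫ ω, (E.indicator (1 : Ω → ℝ) ω + P[E.indicator (1 : Ω → ℝ) | m] ω) ∂P := by
    refine integral_mono_ae (integrable_innovation hE).abs (hei.add integrable_condExp) ?_
    filter_upwards [condExp_indicator_mem_Icc (P := P) hm hE] with ω h
    have h1 : 0 ≤ E.indicator (1 : Ω → ℝ) ω := Set.indicator_nonneg (fun _ _ => zero_le_one) ω
    simp only [innovation, Pi.sub_apply]
    rw [abs_le]
    constructor <;> linarith [h.1]
  rw [integral_add hei integrable_condExp, integral_condExp hm, integral_indicator_one hE] at h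
  linarith

lemma integral_mul_innovation_eq_zero [IsProbabilityMeasure P]
    (hm : m ≤ mΩ) {E : Set Ω} (hE : MeasurableSet E) {f : Ω → ℝ} (hf : StronglyMeasurable[m] f)
    (hf1 : ∀ᵐ ω ∂P, |f ω| ≤ 1) : ∫ ω, f ω * innovation P m E ω ∂P = 0 := by
  have hei : Integrable (E.indicator (1 : Ω → ℝ)) P := (integrable_const (1 : ℝ)).indicator hE
  have hD := integrable_innovation (P := P) (m := m) hE
  have h1 : P[innovation P m E | m] =ᵐ[P] 0 := by
    have h := condExp_sub hei (integrable_condExp (m := m) (f := E.indicator (1 : Ω → ℝ))) m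
    rw [condExp_of_stronglyMeasurable hm stronglyMeasurable_condExp integrable_condExp,
      sub_self] at h
    exact h
  have h2 := condExp_stronglyMeasurable_mul_of_bound hm hf hD 1 hf1
  have h3 : ∫ ω, P[f * innovation P m E | m] ω ∂P = 0 := by
    refine integral_eq_zero_of_ae ?_
    filter_upwards [h1, h2] with ω h1 h2
    simp [h1, h2]
  rw [integral_condExp hm] at h3
  exact h3

lemma integrable_mul_innovation [IsProbabilityMeasure P]
    (hm : m ≤ mΩ) {E E' : Set Ω} (hE : MeasurableSet E) (hE' : MeasurableSet E') :
    Integrable (fun ω => innovation P m E ω * innovation P m' E' ω) P :=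
  (integrable_innovation hE').bdd_mul (integrable_innovation hE).aestronglyMeasurable
    (abs_innovation_le_one hm hE)

/-- Innovations that look back by `g` of events that look ahead by `L` are orthogonal at distance
at least `L + g`, so their sums have linearly growing variance. -/
lemma integral_sq_sum_innovation_le [IsProbabilityMeasure P] {F : ℤ → MeasurableSpace Ω}
    (hF : Monotone F) (hle : ∀ t, F t ≤ mΩ) (L g : ℕ) {E : ℕ → Set Ω}
    (hE : ∀ i : ℕ, MeasurableSet[F (i + L)] (E i)) {p : ℝ} (hp : ∀ i, P.real (E i) = p) (N : ℕ) :
    ∫ ω, (∑ i ∈ Finset.range N, innovation P (F (i - g)) (E i) ω) ^ 2 ∂P ≤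
      4 * (L + g) * N * p := by
  have hEm : ∀ i, MeasurableSet (E i) := fun i => hle _ _ (hE i)
  have hp0 : 0 ≤ p := hp 0 ▸ measureReal_nonneg
  have hsm : ∀ i : ℕ, StronglyMeasurable[F (i + L)] (innovation P (F (i - g)) (E i)) := by
    intro i
    refine StronglyMeasurable.sub ?_ ?_
    · exact (@stronglyMeasurable_const _ _ (F (i + L)) _ (1 : ℝ)).indicator (hE i)
    · exact stronglyMeasurable_condExp.mono (hF (by omega))
  set D : ℕ → Ω → ℝ := fun i => innovation P (F (i - g)) (E i) with hD
  have hDD : ∀ i j, Integrable (fun ω => D i ω * D j ω) P := fun i j =>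
    integrable_mul_innovation (hle _) (hEm i) (hEm j)
  -- `D i` is known at time `i + L ≤ j - g`, and `D j` is centred given the past up to `j - g`.
  have hfar : ∀ i j : ℕ, i + (L + g) ≤ j → ∫ ω, D i ω * D j ω ∂P = 0 := by
    intro i j hij
    exact integral_mul_innovation_eq_zero (hle _) (hEm j) ((hsm i).mono (hF (by omega)))
      (abs_innovation_le_one (hle _) (hEm i))
  have hnear : ∀ i j : ℕ, ∫ ω, D i ω * D j ω ∂P ≤ 2 * p := by
    intro i j
    calc ∫ ω, D i ω * D j ω ∂P ≤ ∫ ω, |D i ω| ∂P := by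
          refine integral_mono_ae (hDD i j) (integrable_innovation (hEm i)).abs ?_
          filter_upwards [abs_innovation_le_one (P := P) (hle (j - g)) (hEm j)] with ω h
          calc D i ω * D j ω ≤ |D i ω * D j ω| := le_abs_self _
            _ = |D i ω| * |D j ω| := abs_mul _ _
            _ ≤ |D i ω| * 1 := by gcongr
            _ = |D i ω| := mul_one _
      _ ≤ 2 * p := hp i ▸ integral_abs_innovation_le (hle _) (hEm i)
  -- The interval is `|i - j| < L + g`; truncated subtraction only cuts it at `0`.
  have hcov : ∀ i j : ℕ, ∫ ω, D i ω * D j ω ∂P ≤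
      if j ∈ Finset.Ico (i + 1 - (L + g)) (i + (L + g)) then 2 * p else 0 := by
    intro i j
    split_ifs with h
    · exact hnear i j
    · rw [Finset.mem_Ico, not_and_or, not_le, not_lt] at h
      rcases h with h | h
      · simp_rw [mul_comm (D i _)]
        exact (hfar j i (by omega)).le
      · exact (hfar i j h).le
  have hexp : ∀ ω, (∑ i ∈ Finset.range N, D i ω) ^ 2 =
      ∑ i ∈ Finset.range N, ∑ j ∈ Finset.range N, D i ω * D j ω := fun ω => by
    rw [sq, Finset.sum_mul_sum]
  change ∫ ω, (∑ i ∈ Finset.range N, D i ω) ^ 2 ∂P ≤ _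
  simp_rw [hexp]
  rw [integral_finsetSum _ fun i _ => integrable_finsetSum _ fun j _ => hDD i j]
  simp_rw [integral_finsetSum _ fun j _ => hDD _ j]
  have hrow : ∀ i, ∑ j ∈ Finset.range N, ∫ ω, D i ω * D j ω ∂P ≤ 4 * (L + g) * p := by
    intro i
    refine (Finset.sum_le_sum fun j _ => hcov i j).trans ?_
    rw [← Finset.sum_filter, Finset.sum_const, nsmul_eq_mul]
    have hc : (((Finset.range N).filter (· ∈ Finset.Ico (i + 1 - (L + g)) (i + (L + g)))).card : ℝ)
        ≤ 2 * (L + g) := by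
      have : ((Finset.range N).filter (· ∈ Finset.Ico (i + 1 - (L + g)) (i + (L + g)))).card ≤
          2 * (L + g) := by
        refine (Finset.card_le_card (t := Finset.Ico (i + 1 - (L + g)) (i + (L + g)))
          fun x hx => (Finset.mem_filter.1 hx).2).trans ?_
        rw [Nat.card_Ico]
        omega
      exact_mod_cast this
    nlinarith
  refine (Finset.sum_le_sum fun i _ => hrow i).trans ?_
  rw [Finset.sum_const, Finset.card_range, nsmul_eq_mul]
  apply le_of_eq
  ring

lemma integral_abs_sum_innovation_le [IsProbabilityMeasure P] {F : ℤ → MeasurableSpace Ω}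
    (hF : Monotone F) (hle : ∀ t, F t ≤ mΩ) (L g : ℕ) {E : ℕ → Set Ω}
    (hE : ∀ i : ℕ, MeasurableSet[F (i + L)] (E i)) {p : ℝ} (hp : ∀ i, P.real (E i) = p) (N : ℕ) :
    ∫ ω, |∑ i ∈ Finset.range N, innovation P (F (i - g)) (E i) ω| ∂P ≤
      √(4 * (L + g) * N * p) := by
  have hEm : ∀ i, MeasurableSet (E i) := fun i => hle _ _ (hE i)
  have hL : MemLp (fun ω => |∑ i ∈ Finset.range N, innovation P (F (i - g)) (E i) ω|) 2 P := by
    refine MemLp.abs ?_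
    refine memLp_finsetSum _ fun i _ => ?_
    refine MemLp.of_bound (integrable_innovation (hEm i)).aestronglyMeasurable 1 ?_
    exact abs_innovation_le_one (hle _) (hEm i)
  -- Nonnegativity of the variance of the absolute value bounds the first moment by the root of the
  -- second.
  have hv := ProbabilityTheory.variance_nonneg
    (fun ω => |∑ i ∈ Finset.range N, innovation P (F (i - g)) (E i) ω|) P
  rw [ProbabilityTheory.variance_eq_sub hL] at hv
  simp only [Pi.pow_apply, sq_abs] at hv
  refine Real.le_sqrt_of_sq_le ?_
  linarith [integral_sq_sum_innovation_le hF hle L g hE hp N]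

end Concentration

/-! ### Relative frequencies -/

section Frequency

open Classical in
/-- The relative frequency of the value `z` among `c 0, …, c (N - 1)`. -/
noncomputable def freq {S : Type*} (N : ℕ) (c : ℕ → S) (z : S) : ℝ :=
  (((Finset.range N).filter fun i => c i = z).card : ℝ) / N

lemma freq_eq_sum {S : Type*} (N : ℕ) (c : ℕ → S) (z : S) :
    freq N c z = (∑ i ∈ Finset.range N, {i | c i = z}.indicator 1 i) / N := by
  classical
  rw [freq, Finset.card_filter, Nat.cast_sum]
  congr 1
  refine Finset.sum_congr rfl fun i _ => ?_
  by_cases h : c i = z <;> simp [h]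

lemma freq_nonneg {S : Type*} (N : ℕ) (c : ℕ → S) (z : S) : 0 ≤ freq N c z := by
  unfold freq; positivity

lemma hasSum_freq {S : Type*} {N : ℕ} (hN : N ≠ 0) (c : ℕ → S) : HasSum (freq N c) 1 := by
  classical
  have h : ∀ i, HasSum (fun z => {i | c i = z}.indicator (1 : ℕ → ℝ) i) 1 := by
    intro i
    convert hasSum_ite_eq (c i) (1 : ℝ) using 1
    ext z
    by_cases hz : c i = z <;> simp [hz, eq_comm]
    simp [Ne.symm hz]
  have h2 := (hasSum_sum fun i (_ : i ∈ Finset.range N) => h i).div_const (N : ℝ)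
  simp only [← freq_eq_sum] at h2
  simpa [hN] using h2

end Frequency

/-! ### Concentration of empirical cell frequencies -/

section Concentration

variable {Ω : Type*} [mΩ : MeasurableSpace Ω] {P : Measure Ω} {X : ℤ → Ω → ℝ}

/-- The window `(X_i, …, X_{i+L})`. -/
def window (X : ℤ → Ω → ℝ) (L : ℕ) (i : ℤ) (ω : Ω) : Fin (L + 1) → ℝ :=
  fun k => X (i + (k : ℕ)) ω

lemma measurable_window (hX : ∀ s, Measurable (X s)) (L : ℕ) (i : ℤ) :
    Measurable (window X L i) :=
  measurable_pi_lambda _ fun _ => hX _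

lemma IsStationary.real_window_preimage [IsProbabilityMeasure P] (hX : ∀ s, Measurable (X s))
    (hstat : IsStationary P X) (L : ℕ) {A : Set (Fin (L + 1) → ℝ)} (hA : MeasurableSet A)
    (s t : ℤ) : P.real (window X L s ⁻¹' A) = P.real (window X L t ⁻¹' A) := by
  have hφ : Measurable fun (x : ℤ → ℝ) (k : Fin (L + 1)) => x ((k : ℕ) : ℤ) :=
    measurable_pi_lambda _ fun _ => measurable_pi_apply _
  have h : P.map (window X L s) = P.map (window X L t) := hstat.map_comp_shift hX hφ s t
  rw [← map_measureReal_apply (measurable_window hX L s) hA, h,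
    map_measureReal_apply (measurable_window hX L t) hA]

/-- By Cauchy–Schwarz, summing the standard deviations of the cells costs only the square root of
their number. -/
lemma sum_sqrt_le {S : Type*} (B : Finset S) {p : S → ℝ} (hp : ∀ b, 0 ≤ p b)
    (hsum : ∑ b ∈ B, p b ≤ 1) {K : ℝ} (hK : 0 ≤ K) :
    ∑ b ∈ B, √(K * p b) ≤ √(B.card * K) := by
  refine Real.le_sqrt_of_sq_le (sq_sum_le_card_mul_sum_sq.trans ?_)
  have : ∑ b ∈ B, √(K * p b) ^ 2 = K * ∑ b ∈ B, p b := by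
    rw [Finset.mul_sum]
    exact Finset.sum_congr rfl fun b _ => Real.sq_sqrt (mul_nonneg hK (hp b))
  rw [this]
  gcongr
  nlinarith

/-- Empirical cell frequencies of a stationary process are close to the cell probabilities. -/
theorem integral_sum_abs_freq_sub_le [IsProbabilityMeasure P] (hX : ∀ s, Measurable (X s))
    (hstat : IsStationary P X) {S : Type*} [MeasurableSpace S] [MeasurableSingletonClass S]
    {L : ℕ} {ψ : (Fin (L + 1) → ℝ) → S} (hψ : Measurable ψ) (B : Finset S) (g : ℕ) (t : ℤ)
    {N : ℕ} (hN : N ≠ 0) :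
    Integrable (fun ω => ∑ b ∈ B, |freq N (fun i => ψ (window X L i ω)) b -
        P.real (window X L t ⁻¹' (ψ ⁻¹' {b}))|) P ∧
    ∫ ω, ∑ b ∈ B, |freq N (fun i => ψ (window X L i ω)) b -
        P.real (window X L t ⁻¹' (ψ ⁻¹' {b}))| ∂P ≤
      2 * betaCoef P X t g + √(4 * (L + g) * B.card / N) := by
  have hN0 : (0 : ℝ) < N := by positivity
  have hψb : ∀ b, MeasurableSet (ψ ⁻¹' {b}) := fun b => hψ (measurableSet_singleton b)
  set p : S → ℝ := fun b => P.real (window X L t ⁻¹' (ψ ⁻¹' {b})) with hpdef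
  let E : S → ℕ → Set Ω := fun b i => window X L i ⁻¹' (ψ ⁻¹' {b})
  have hEp : ∀ b i, P.real (E b i) = p b := fun b i =>
    hstat.real_window_preimage hX L (hψb b) i t
  have hEF : ∀ b (i : ℕ), MeasurableSet[pastSigma X (i + L)] (E b i) := by
    intro b i
    have : Measurable[pastSigma X (i + L)] (window X L i) :=
      @measurable_pi_lambda _ _ _ (pastSigma X (i + L)) _ _ fun k =>
        measurable_pastSigma (by have := k.2; omega)
    exact this (hψb b)
  have hEm : ∀ b i, MeasurableSet (E b i) := fun b i => pastSigma_le hX _ _ (hEF b i)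
  let c : S → ℕ → Ω → ℝ := fun b i => P[(E b i).indicator (1 : Ω → ℝ) | pastSigma X (i - g)]
  let D : S → ℕ → Ω → ℝ := fun b i => innovation P (pastSigma X (i - g)) (E b i)
  have hfreq : ∀ b ω, freq N (fun i => ψ (window X L i ω)) b =
      (∑ i ∈ Finset.range N, (E b i).indicator (1 : Ω → ℝ) ω) / N := by
    intro b ω
    rw [freq_eq_sum]
    rfl
  -- The innovations `D` are controlled through their variance, cell by cell; the conditional biases
  -- `c - p` are controlled through mixing, all cells at once.
  have hdecomp : ∀ b ω, freq N (fun i => ψ (window X L i ω)) b - p b =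
      (∑ i ∈ Finset.range N, D b i ω + ∑ i ∈ Finset.range N, (c b i ω - p b)) / N := by
    intro b ω
    rw [hfreq, ← Finset.sum_add_distrib, eq_div_iff hN0.ne', sub_mul, div_mul_cancel₀ _ hN0.ne']
    have : ∀ i, D b i ω + (c b i ω - p b) = (E b i).indicator (1 : Ω → ℝ) ω - p b := by
      intro i
      simp only [D, c, innovation, Pi.sub_apply]
      ring
    simp_rw [this]
    rw [Finset.sum_sub_distrib, Finset.sum_const, Finset.card_range, nsmul_eq_mul]
    ring
  have hDint : ∀ b, Integrable (fun ω => |∑ i ∈ Finset.range N, D b i ω|) P := fun b =>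
    (integrable_finsetSum _ fun i _ => integrable_innovation (hEm b i)).abs
  have hcint : ∀ b i, Integrable (fun ω => |c b i ω - p b|) P := fun b i =>
    (integrable_condExp.sub (integrable_const _)).abs
  have hDD : ∀ b, Integrable (fun ω => |freq N (fun i => ψ (window X L i ω)) b - p b|) P := by
    intro b
    simp_rw [hfreq]
    exact (((integrable_finsetSum _ fun i _ =>
      (integrable_const (1 : ℝ)).indicator (hEm b i)).div_const _).sub (integrable_const _)).abs
  have hb : ∀ b, ∫ ω, |freq N (fun i => ψ (window X L i ω)) b - p b| ∂P ≤
      (√(4 * (L + g) * N * p b) + ∑ i ∈ Finset.range N, ∫ ω, |c b i ω - p b| ∂P) / N := by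
    intro b
    calc ∫ ω, |freq N (fun i => ψ (window X L i ω)) b - p b| ∂P
        ≤ ∫ ω, (|∑ i ∈ Finset.range N, D b i ω| +
            ∑ i ∈ Finset.range N, |c b i ω - p b|) / N ∂P := by
          refine integral_mono (hDD b) (((hDint b).add
            (integrable_finsetSum _ fun i _ => hcint b i)).div_const _) fun ω => ?_
          simp only [hdecomp, abs_div, Nat.abs_cast]
          gcongr
          exact (abs_add_le _ _).trans (by gcongr; exact Finset.abs_sum_le_sum_abs _ _)
      _ = (∫ ω, |∑ i ∈ Finset.range N, D b i ω| ∂P +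
            ∑ i ∈ Finset.range N, ∫ ω, |c b i ω - p b| ∂P) / N := by
          rw [integral_div, integral_add (hDint b) (integrable_finsetSum _ fun i _ => hcint b i),
            integral_finsetSum _ fun i _ => hcint b i]
      _ ≤ _ := by
          gcongr
          exact integral_abs_sum_innovation_le pastSigma_mono (pastSigma_le hX) L g (hEF b)
            (hEp b) N
  -- The window starting at `i` is part of the future at `(i - g) + g`, and distinct cells give
  -- disjoint future events.
  have hcol : ∀ i : ℕ, ∑ b ∈ B, ∫ ω, |c b i ω - p b| ∂P ≤ 2 * betaCoef P X t g := by
    intro i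
    have hGm : ∀ b, MeasurableSet
        {x : ℕ → ℝ | ψ (fun k : Fin (L + 1) => x (k : ℕ)) = b} := by
      intro b
      have : Measurable fun (x : ℕ → ℝ) (k : Fin (L + 1)) => x (k : ℕ) :=
        measurable_pi_lambda _ fun _ => measurable_pi_apply _
      exact this (hψb b)
    have hG := sum_integral_abs_condExp_sub_le (P := P) hX (i - g) g B hGm
      (fun b b' hbb => Set.disjoint_left.2 fun x hx hx' => hbb (hx.symm.trans hx'))
    have hE : ∀ b, future X ((i : ℤ) - g + g) ⁻¹'
        {x : ℕ → ℝ | ψ (fun k : Fin (L + 1) => x (k : ℕ)) = b} = E b i := by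
      intro b
      rw [sub_add_cancel]
      rfl
    simp only [hE, hEp] at hG
    rwa [hstat.betaCoef_eq hX _ t] at hG
  have hpsum : ∑ b ∈ B, p b ≤ 1 := by
    rw [← measureReal_biUnion_finset]
    · exact measureReal_le_one
    · intro b _ b' _ hbb
      exact Set.disjoint_left.2 fun x hx hx' => hbb (hx.symm.trans hx')
    · exact fun b _ => measurable_window hX L t (hψb b)
  refine ⟨integrable_finsetSum _ fun b _ => hDD b, ?_⟩
  rw [integral_finsetSum _ fun b _ => hDD b]
  refine (Finset.sum_le_sum fun b _ => hb b).trans ?_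
  rw [← Finset.sum_div, Finset.sum_add_distrib, Finset.sum_comm, add_div, add_comm]
  gcongr
  · rw [div_le_iff₀ hN0]
    refine (Finset.sum_le_sum fun i _ => hcol i).trans ?_
    rw [Finset.sum_const, Finset.card_range, nsmul_eq_mul, mul_comm]
  · rw [div_le_iff₀ hN0]
    refine (sum_sqrt_le B (fun b => measureReal_nonneg) hpsum (by positivity)).trans ?_
    refine Real.sqrt_le_iff.2 ⟨by positivity, ?_⟩
    rw [mul_pow, Real.sq_sqrt (by positivity)]
    apply le_of_eq
    field_simp

end Concentration

/-! ### Comparison of ℓ¹ distances -/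

section Comparison

variable {S : Type*}

/-- Off `B` the difference is at most `f + q`, and as both masses are 1, the mass of `f` off `B`
exceeds that of `q` by at most the ℓ¹ error on `B`. Only the tail of the true law then needs a
bound, not the empirical one. -/
lemma tsum_abs_sub_le_of_finset {f q : S → ℝ} (hf0 : ∀ s, 0 ≤ f s) (hf : HasSum f 1)
    (hq0 : ∀ s, 0 ≤ q s) (hq : HasSum q 1) (B : Finset S) :
    ∑' s, |f s - q s| ≤ 2 * ∑ s ∈ B, |f s - q s| + 2 * (1 - ∑ s ∈ B, q s) := by
  classical
  have h1 : HasSum ((B : Set S).indicator fun s => |f s - q s| - (f s + q s))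
      (∑ s ∈ B, (|f s - q s| - (f s + q s))) :=
    hasSum_subtype_iff_indicator.1 (B.hasSum _)
  have h2 := (hf.add hq).add h1
  have h3 : ∑' s, |f s - q s| ≤ 1 + 1 + ∑ s ∈ B, (|f s - q s| - (f s + q s)) := by
    rw [← h2.tsum_eq]
    refine Summable.tsum_le_tsum (fun s => ?_) (hf.summable.sub hq.summable).abs h2.summable
    by_cases hs : s ∈ B
    · simp [hs]
    · have : |f s - q s| ≤ f s + q s := by
        rw [abs_le]; constructor <;> linarith [hf0 s, hq0 s]
      simpa [hs] using this
  have h4 : ∑ s ∈ B, q s - ∑ s ∈ B, f s ≤ ∑ s ∈ B, |f s - q s| := by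
    rw [← Finset.sum_sub_distrib]
    exact Finset.sum_le_sum fun s _ => by rw [abs_sub_comm]; exact le_abs_self _
  rw [Finset.sum_sub_distrib, Finset.sum_add_distrib] at h3
  linarith

lemma hasSum_prod_mul {f g : S → ℝ} (hf0 : ∀ s, 0 ≤ f s) {x y : ℝ} (hf : HasSum f x)
    (hg0 : ∀ s, 0 ≤ g s) (hg : HasSum g y) :
    HasSum (fun z : S × S => f z.1 * g z.2) (x * y) :=
  hf.mul hg (hf.summable.mul_of_nonneg hg.summable hf0 hg0)

lemma tsum_abs_mul_sub_mul_le {f q : S → ℝ} (hf0 : ∀ s, 0 ≤ f s) (hf : HasSum f 1)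
    (hq0 : ∀ s, 0 ≤ q s) (hq : HasSum q 1) :
    ∑' z : S × S, |f z.1 * f z.2 - q z.1 * q z.2| ≤ 2 * ∑' s, |f s - q s| := by
  have hfq : HasSum (fun s => |f s - q s|) (∑' s, |f s - q s|) :=
    (hf.summable.sub hq.summable).abs.hasSum
  have h1 := hasSum_prod_mul (fun s => abs_nonneg (f s - q s)) hfq hf0 hf
  have h2 := hasSum_prod_mul hq0 hq (fun s => abs_nonneg (f s - q s)) hfq
  have h3 := h1.add h2
  have h4 : ∑' z : S × S, |f z.1 * f z.2 - q z.1 * q z.2| ≤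
      (∑' s, |f s - q s|) * 1 + 1 * ∑' s, |f s - q s| := by
    rw [← h3.tsum_eq]
    refine Summable.tsum_le_tsum (fun z => ?_) ?_ h3.summable
    · have : f z.1 * f z.2 - q z.1 * q z.2 =
          (f z.1 - q z.1) * f z.2 + q z.1 * (f z.2 - q z.2) := by ring
      rw [this]
      refine (abs_add_le _ _).trans ?_
      rw [abs_mul, abs_mul, abs_of_nonneg (hf0 z.2), abs_of_nonneg (hq0 z.1)]
    · exact ((hasSum_prod_mul hf0 hf hf0 hf).summable.sub
        (hasSum_prod_mul hq0 hq hq0 hq).summable).abs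
  linarith

/-- Reverse triangle inequality in ℓ¹; replacing the product costs one marginal error per factor,
and the two cancel the factor `1 / 2`. -/
lemma abs_half_tsum_sub_half_tsum_le {f q : S → ℝ} {F Q : S × S → ℝ} (hf0 : ∀ s, 0 ≤ f s)
    (hf : HasSum f 1) (hq0 : ∀ s, 0 ≤ q s) (hq : HasSum q 1) (hF : HasSum F 1)
    (hQ : HasSum Q 1) :
    |(1 / 2) * ∑' z : S × S, |F z - f z.1 * f z.2| -
      ((1 / 2) * ∑' z : S × S, |q z.1 * q z.2 - Q z|)| ≤
      (1 / 2) * ∑' z, |F z - Q z| + ∑' s, |f s - q s| := by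
  have hff := (hasSum_prod_mul hf0 hf hf0 hf).summable
  have hqq := (hasSum_prod_mul hq0 hq hq0 hq).summable
  have s1 := (hF.summable.sub hff).abs
  have s2 := (hqq.sub hQ.summable).abs
  have s3 := (hF.summable.sub hQ.summable).abs
  have s4 := (hff.sub hqq).abs
  have h := tsum_abs_mul_sub_mul_le hf0 hf hq0 hq
  have h1 : ∑' z : S × S, |F z - f z.1 * f z.2| ≤ ∑' z : S × S, |q z.1 * q z.2 - Q z| +
      (∑' z, |F z - Q z| + ∑' z : S × S, |f z.1 * f z.2 - q z.1 * q z.2|) := by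
    rw [← s3.tsum_add s4, ← s2.tsum_add (s3.add s4)]
    refine Summable.tsum_le_tsum (fun z => ?_) s1 (s2.add (s3.add s4))
    grind
  have h2 : ∑' z : S × S, |q z.1 * q z.2 - Q z| ≤ ∑' z : S × S, |F z - f z.1 * f z.2| +
      (∑' z, |F z - Q z| + ∑' z : S × S, |f z.1 * f z.2 - q z.1 * q z.2|) := by
    rw [← s3.tsum_add s4, ← s1.tsum_add (s3.add s4)]
    refine Summable.tsum_le_tsum (fun z => ?_) s2 (s1.add (s3.add s4))
    grind
  rw [abs_le]
  constructor <;> linarith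

end Comparison

/-! ### Grid cells and histograms -/

section Cells

variable {ι : Type*}

/-- The index of the cube of side `h` that contains `x`. -/
noncomputable def cell (h : ℝ) (x : ι → ℝ) : ι → ℤ := fun k => ⌊x k / h⌋

lemma measurable_cell (h : ℝ) : Measurable (cell h : (ι → ℝ) → ι → ℤ) :=
  measurable_pi_lambda _ fun k => by
    have hk : Measurable fun x : ι → ℝ => x k := measurable_pi_apply k
    exact Int.measurable_floor.comp (hk.div_const h)

lemma cell_preimage_singleton {h : ℝ} (hh : 0 < h) (z : ι → ℤ) :
    cell h ⁻¹' {z} = Set.univ.pi fun k => Set.Ico (z k * h) ((z k + 1) * h) := by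
  ext x
  simp only [Set.mem_preimage, Set.mem_singleton_iff, funext_iff, cell, Set.mem_pi, Set.mem_univ,
    true_implies, Set.mem_Ico, Int.floor_eq_iff, le_div_iff₀ hh, div_lt_iff₀ hh]

variable [Fintype ι]

lemma volume_cell_preimage {h : ℝ} (hh : 0 < h) (z : ι → ℤ) :
    volume (cell h ⁻¹' {z}) = ENNReal.ofReal (h ^ Fintype.card ι) := by
  rw [cell_preimage_singleton hh, Real.volume_pi_Ico, ENNReal.ofReal_pow hh.le]
  have : ∀ k, ((z k : ℝ) + 1) * h - z k * h = h := fun k => by ring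
  simp [this]

/-- All cells have the same volume, so the cell map pushes Lebesgue measure to a multiple of
counting measure. -/
lemma integral_comp_cell_prod {h : ℝ} (hh : 0 < h) {g : (ι → ℤ) × (ι → ℤ) → ℝ}
    (hg : Summable g) :
    ∫ p : (ι → ℝ) × (ι → ℝ), g (cell h p.1, cell h p.2) =
      h ^ Fintype.card ι * h ^ Fintype.card ι * ∑' z, g z := by
  have hm : Measurable fun p : (ι → ℝ) × (ι → ℝ) => (cell h p.1, cell h p.2) :=
    ((measurable_cell h).comp measurable_fst).prodMk ((measurable_cell h).comp measurable_snd)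
  have hs : ∀ z, (volume.map fun p : (ι → ℝ) × (ι → ℝ) => (cell h p.1, cell h p.2)) {z} =
      ENNReal.ofReal (h ^ Fintype.card ι * h ^ Fintype.card ι) := by
    intro z
    rw [Measure.map_apply hm (measurableSet_singleton z)]
    have : (fun p : (ι → ℝ) × (ι → ℝ) => (cell h p.1, cell h p.2)) ⁻¹' {z} =
        (cell h ⁻¹' {z.1}) ×ˢ (cell h ⁻¹' {z.2}) := by
      ext p
      simp [Prod.ext_iff]
    rw [this, Measure.volume_eq_prod, Measure.prod_prod, volume_cell_preimage hh,
      volume_cell_preimage hh, ← ENNReal.ofReal_mul (by positivity)]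
  have hmap : (volume.map fun p : (ι → ℝ) × (ι → ℝ) => (cell h p.1, cell h p.2)) =
      ENNReal.ofReal (h ^ Fintype.card ι * h ^ Fintype.card ι) • Measure.count := by
    refine Measure.ext_of_singleton fun z => ?_
    rw [hs]
    simp
  have hgi : Integrable g (volume.map fun p : (ι → ℝ) × (ι → ℝ) => (cell h p.1, cell h p.2)) := by
    rw [hmap]
    exact (integrable_count_iff.2 hg.norm).smul_measure ENNReal.ofReal_ne_top
  rw [← integral_map hm.aemeasurable hgi.aestronglyMeasurable, integral_countable hgi,
    ← tsum_mul_left]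
  refine tsum_congr fun z => ?_
  rw [Measure.real, hs, ENNReal.toReal_ofReal (by positivity), smul_eq_mul]

lemma histogram_eq_freq (h : ℝ) (N : ℕ) (y : ℕ → ι → ℝ) (x : ι → ℝ) :
    histogram h N y x = freq N (fun i => cell h (y i)) (cell h x) / h ^ Fintype.card ι := by
  rw [histogram, freq, div_div]
  congr 3
  ext i
  simp [funext_iff, cell]

end Cells

lemma betaHat_eq_tsum (x : ℤ → ℝ) (n d a : ℕ) {h : ℝ} (hh : 0 < h) (h1 : n + 1 - d ≠ 0)
    (h2 : n + 2 - (2 * d + a) ≠ 0) :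
    betaHat x n d a h = (1 / 2) * ∑' z : (Fin d → ℤ) × (Fin d → ℤ),
      |freq (n + 2 - (2 * d + a)) (fun i => (cell h fun k : Fin d => x (i + 1 + (k : ℕ)),
          cell h fun k : Fin d => x (i + d + a + (k : ℕ)))) z -
        freq (n + 1 - d) (fun i => cell h fun k : Fin d => x (i + 1 + (k : ℕ))) z.1 *
        freq (n + 1 - d) (fun i => cell h fun k : Fin d => x (i + 1 + (k : ℕ))) z.2| := by
  set f := freq (n + 1 - d) (fun i => cell h fun k : Fin d => x (i + 1 + (k : ℕ))) with hf
  set F := freq (n + 2 - (2 * d + a)) (fun i => (cell h fun k : Fin d => x (i + 1 + (k : ℕ)),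
          cell h fun k : Fin d => x (i + d + a + (k : ℕ)))) with hF
  have hs : Summable fun z : (Fin d → ℤ) × (Fin d → ℤ) =>
      |F z - f z.1 * f z.2| / (h ^ d * h ^ d) :=
    ((hasSum_freq h2 _).summable.sub (hasSum_prod_mul (freq_nonneg _ _)
      (hasSum_freq h1 _) (freq_nonneg _ _) (hasSum_freq h1 _)).summable).abs.div_const _
  have hI := integral_comp_cell_prod hh hs
  rw [tsum_div_const, Fintype.card_fin, mul_div_cancel₀ _ (by positivity)] at hI
  rw [← hI, betaHat]
  congr 2
  ext p
  have hp : fHatPair x n d a h (Sum.elim p.1 p.2) =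
      F (cell h p.1, cell h p.2) / (h ^ d * h ^ d) := by
    rw [fHatPair, histogram_eq_freq, Fintype.card_sum, Fintype.card_fin, pow_add, hF, freq, freq]
    congr 4
    ext i
    simp [funext_iff, cell, Prod.ext_iff]
  rw [hp, fHat, histogram_eq_freq, histogram_eq_freq, Fintype.card_fin, div_mul_div_comm,
    ← sub_div, abs_div, abs_of_pos (show 0 < h ^ d * h ^ d by positivity)]

/-! ### Approximation of events by functions of the bins -/

section Approximation

variable {T : Type*} [mT : MeasurableSpace T] {S : ℕ → Type*}

/-- The measurable sets that are, asymptotically and up to small `ρ`-measure, determined by the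
value of `φ n`. -/
abbrev approxSigma (ρ : Measure T) [IsFiniteMeasure ρ] (φ : ∀ n, T → S n) : MeasurableSpace T where
  MeasurableSet' C := MeasurableSet C ∧ ∀ ε : ENNReal, 0 < ε →
    ∀ᶠ n in atTop, ∃ A : Set (S n), ρ (symmDiff (φ n ⁻¹' A) C) ≤ ε
  measurableSet_empty := ⟨MeasurableSet.empty, fun ε _ => Eventually.of_forall fun n =>
    ⟨∅, by simp⟩⟩
  measurableSet_compl C hC := ⟨hC.1.compl, fun ε hε => (hC.2 ε hε).mono fun n ⟨A, hA⟩ =>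
    ⟨Aᶜ, by rwa [Set.preimage_compl, compl_symmDiff_compl]⟩⟩
  measurableSet_iUnion f hf := by
    refine ⟨MeasurableSet.iUnion fun i => (hf i).1, fun ε hε => ?_⟩
    have hacc : ∀ K, MeasurableSet (Set.accumulate f K) := fun K =>
      MeasurableSet.biUnion (Set.to_countable _) fun i _ => (hf i).1
    have hlim : Tendsto (fun K => ρ ((⋃ i, f i) \ Set.accumulate f K)) atTop (𝓝 0) := by
      have h := tendsto_measure_iInter_atTop (μ := ρ)
        (s := fun K => (⋃ i, f i) \ Set.accumulate f K)
        (fun K => ((MeasurableSet.iUnion fun i => (hf i).1).diff (hacc K)).nullMeasurableSet)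
        (fun K K' hK => Set.sdiff_subset_sdiff_right (Set.monotone_accumulate hK))
        ⟨0, measure_ne_top _ _⟩
      have h0 : ⋂ K, ((⋃ i, f i) \ Set.accumulate f K) = ∅ := by
        rw [← Set.sdiff_iUnion, Set.iUnion_accumulate, Set.sdiff_self]
      rwa [h0, measure_empty] at h
    -- Half of the error cuts the union at a finite stage `K`; the other half is shared by the `K +
    -- 1` remaining sets.
    have hε2 : 0 < ε / 2 := ENNReal.half_pos hε.ne'
    obtain ⟨K, hK⟩ := (hlim.eventually (gt_mem_nhds hε2)).exists
    have hεK : 0 < ε / 2 / (K + 1 : ℕ) :=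
      ENNReal.div_pos hε2.ne' (ENNReal.natCast_ne_top _)
    have hev : ∀ᶠ n in atTop, ∀ i ∈ Finset.range (K + 1), ∃ A : Set (S n),
        ρ (symmDiff (φ n ⁻¹' A) (f i)) ≤ ε / 2 / (K + 1 : ℕ) :=
      (eventually_all_finset _).2 fun i _ => (hf i).2 _ hεK
    filter_upwards [hev] with n hn
    choose! A hA using hn
    refine ⟨⋃ i ∈ Finset.range (K + 1), A i, ?_⟩
    have hsub : symmDiff (φ n ⁻¹' ⋃ i ∈ Finset.range (K + 1), A i) (⋃ i, f i) ⊆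
        (⋃ i ∈ Finset.range (K + 1), symmDiff (φ n ⁻¹' A i) (f i)) ∪
          ((⋃ i, f i) \ Set.accumulate f K) := by
      intro x hx
      simp only [Set.mem_symmDiff, Set.mem_preimage, Set.mem_iUnion, Set.mem_union, Set.mem_sdiff,
        Set.mem_accumulate, Finset.mem_range, exists_prop, Nat.lt_succ_iff] at hx ⊢
      by_cases h1 : ∃ i ≤ K, φ n x ∈ A i ∧ x ∉ f i ∨ x ∈ f i ∧ φ n x ∉ A i
      · exact Or.inl h1
      · right
        push Not at h1
        grind
    calc ρ (symmDiff (φ n ⁻¹' ⋃ i ∈ Finset.range (K + 1), A i) (⋃ i, f i))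
        ≤ ∑ i ∈ Finset.range (K + 1), ρ (symmDiff (φ n ⁻¹' A i) (f i)) +
          ρ ((⋃ i, f i) \ Set.accumulate f K) :=
          (measure_mono hsub).trans ((measure_union_le _ _).trans
            (add_le_add_left (measure_biUnion_finset_le _ _) _))
      _ ≤ ∑ i ∈ Finset.range (K + 1), ε / 2 / (K + 1 : ℕ) + ε / 2 :=
          add_le_add (Finset.sum_le_sum fun i hi => hA i hi) hK.le
      _ = ε := by
          rw [Finset.sum_const, Finset.card_range, nsmul_eq_mul,
            ENNReal.mul_div_cancel (by simp) (ENNReal.natCast_ne_top _), ENNReal.add_halves]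

/-- The set `{u < c}` differs from the union of the bins strictly below that of `c` only inside the
strip `c - h n < u < c`. Such strips shrink to the empty set, so atoms of the law at `c` do no harm.
-/
lemma measurable_approxSigma (ρ : Measure T) [IsFiniteMeasure ρ] (φ : ∀ n, T → S n) {h : ℕ → ℝ}
    (hpos : ∀ n, 0 < h n) (h0 : Tendsto h atTop (𝓝 0)) {u : T → ℝ} (hu : Measurable u)
    (hφ : ∀ᶠ n in atTop, ∃ r : S n → ℤ, ∀ x, r (φ n x) = ⌊u x / h n⌋) :
    Measurable[approxSigma ρ φ] u := by
  refine measurable_of_Iio fun c => ?_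
  refine ⟨hu measurableSet_Iio, fun ε hε => ?_⟩
  have hlim : Tendsto (fun m : ℕ => ρ (u ⁻¹' Set.Ico (c - 1 / ((m : ℝ) + 1)) c)) atTop (𝓝 0) := by
    have h := tendsto_measure_iInter_atTop (μ := ρ)
      (s := fun m : ℕ => u ⁻¹' Set.Ico (c - 1 / ((m : ℝ) + 1)) c)
      (fun m => (hu measurableSet_Ico).nullMeasurableSet)
      (fun m m' hm => Set.preimage_mono (Set.Ico_subset_Ico_left
        (sub_le_sub_left (Nat.one_div_le_one_div hm) c)))
      ⟨0, measure_ne_top _ _⟩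
    have he : ⋂ m : ℕ, u ⁻¹' Set.Ico (c - 1 / ((m : ℝ) + 1)) c = ∅ := by
      refine Set.eq_empty_iff_forall_notMem.2 fun x hx => ?_
      simp only [Set.mem_iInter, Set.mem_preimage, Set.mem_Ico] at hx
      obtain ⟨m, hm⟩ := exists_nat_one_div_lt (sub_pos.2 (hx 0).2)
      linarith [(hx m).1]
    rwa [he, measure_empty] at h
  obtain ⟨m, hm⟩ := (hlim.eventually (gt_mem_nhds hε)).exists
  have hhm : ∀ᶠ n in atTop, h n < 1 / ((m : ℝ) + 1) := h0.eventually (gt_mem_nhds (by positivity))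
  filter_upwards [hφ, hhm] with n ⟨r, hr⟩ hn
  refine ⟨{s | r s < ⌊c / h n⌋}, (measure_mono ?_).trans hm.le⟩
  have hp := hpos n
  intro x hx
  simp only [Set.mem_symmDiff, Set.mem_preimage, Set.mem_ofPred_eq, hr, Set.mem_Iio, not_lt] at hx
  rcases hx with ⟨h1, h2⟩ | ⟨h1, h2⟩
  · exact absurd h1 (not_lt.2 (Int.floor_mono (by gcongr)))
  · refine ⟨?_, h1⟩
    have h3 : (⌊c / h n⌋ : ℝ) ≤ u x / h n := (Int.cast_le.2 h2).trans (Int.floor_le _)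
    have h4 : c / h n < u x / h n + 1 := by linarith [Int.lt_floor_add_one (c / h n)]
    rw [div_add_one hp.ne', div_lt_div_iff_of_pos_right hp] at h4
    linarith

/-- Binning never increases the distance, since test sets pull back. Conversely, a nearly optimal
set is approximated by a pulled-back one; smallness under `μ + ν` controls both measures. -/
lemma tendsto_tvDist_map [∀ n, MeasurableSpace (S n)] [∀ n, DiscreteMeasurableSpace (S n)]
    (μ ν : Measure T) [IsProbabilityMeasure μ] [IsProbabilityMeasure ν] {φ : ∀ n, T → S n}
    (hφ : ∀ n, Measurable (φ n)) (hle : mT ≤ approxSigma (μ + ν) φ) :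
    Tendsto (fun n => tvDist (μ.map (φ n)) (ν.map (φ n))) atTop (𝓝 (tvDist μ ν)) := by
  have hpμ : ∀ n, IsProbabilityMeasure (μ.map (φ n)) := fun n =>
    Measure.isProbabilityMeasure_map (hφ n).aemeasurable
  have hpν : ∀ n, IsProbabilityMeasure (ν.map (φ n)) := fun n =>
    Measure.isProbabilityMeasure_map (hφ n).aemeasurable
  have hup : ∀ n, tvDist (μ.map (φ n)) (ν.map (φ n)) ≤ tvDist μ ν := by
    intro n
    refine tvDist_le fun C hC => ?_
    rw [map_measureReal_apply (hφ n) hC, map_measureReal_apply (hφ n) hC]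
    exact abs_sub_le_tvDist μ ν (hφ n hC)
  refine tendsto_order.2 ⟨fun r hr => ?_, fun r hr => Eventually.of_forall fun n =>
    (hup n).trans_lt hr⟩
  obtain ⟨C, hC, hrC⟩ := exists_lt_abs_sub hr
  set δ := |μ.real C - ν.real C| - r with hδ
  have hδ0 : 0 < δ := sub_pos.2 hrC
  filter_upwards [(hle C hC).2 (ENNReal.ofReal (δ / 2)) (by positivity)] with n ⟨A, hA⟩
  have hAm : MeasurableSet A := MeasurableSet.of_discrete
  have h1 := abs_sub_le_tvDist (μ.map (φ n)) (ν.map (φ n)) hAm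
  rw [map_measureReal_apply (hφ n) hAm, map_measureReal_apply (hφ n) hAm] at h1
  set D := φ n ⁻¹' A
  have h2 : (μ + ν).real (symmDiff D C) ≤ δ / 2 :=
    ENNReal.toReal_le_of_le_ofReal (by positivity) hA
  rw [measureReal_add_apply] at h2
  have h3 := abs_measureReal_sub_le_measureReal_symmDiff (μ := μ)
    (hφ n hAm).nullMeasurableSet hC.nullMeasurableSet
  have h4 := abs_measureReal_sub_le_measureReal_symmDiff (μ := ν)
    (hφ n hAm).nullMeasurableSet hC.nullMeasurableSet
  have h5 : |μ.real C - ν.real C| ≤ |μ.real D - ν.real D| + |μ.real D - μ.real C| +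
      |ν.real D - ν.real C| := by grind
  linarith

end Approximation

/-! ### Vanishing bias -/

section Grid

/-- The cells of the last `d` observations of the past and of the first `d` of the future. -/
noncomputable def gridMap (h : ℝ) (d : ℕ) (p : (ℕ → ℝ) × (ℕ → ℝ)) : (Fin d → ℤ) × (Fin d → ℤ) :=
  (cell h fun k : Fin d => p.1 (d - 1 - k), cell h fun k : Fin d => p.2 k)

lemma measurable_gridMap (h : ℝ) (d : ℕ) : Measurable (gridMap h d) :=
  ((measurable_cell h).comp (measurable_pi_lambda _ fun _ =>
    (measurable_pi_apply _).comp measurable_fst)).prodMk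
  ((measurable_cell h).comp (measurable_pi_lambda _ fun _ =>
    (measurable_pi_apply _).comp measurable_snd))

/-- Each coordinate of past and future is eventually read by the grid, at a resolution tending to
zero, and the coordinates generate the product σ-algebra. -/
lemma tendsto_tvDist_gridMap (μ ν : Measure ((ℕ → ℝ) × (ℕ → ℝ))) [IsProbabilityMeasure μ]
    [IsProbabilityMeasure ν] {d : ℕ → ℕ} (hd : Tendsto d atTop atTop) {h : ℕ → ℝ}
    (hpos : ∀ n, 0 < h n) (h0 : Tendsto h atTop (𝓝 0)) :
    Tendsto (fun n => tvDist (μ.map (gridMap (h n) (d n))) (ν.map (gridMap (h n) (d n)))) atTop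
      (𝓝 (tvDist μ ν)) := by
  refine tendsto_tvDist_map μ ν (fun n => measurable_gridMap _ _) ?_
  have h1 : Measurable[approxSigma (μ + ν) fun n => gridMap (h n) (d n)]
      fun p : (ℕ → ℝ) × (ℕ → ℝ) => p.1 := by
    refine @measurable_pi_lambda _ _ _ (_) _ _ fun k => ?_
    refine measurable_approxSigma _ _ hpos h0 ((measurable_pi_apply k).comp measurable_fst) ?_
    filter_upwards [hd.eventually_gt_atTop k] with n hn
    -- The past is listed backwards and the block forwards, so coordinate `k` sits in slot `d n - 1
    -- - k`.
    refine ⟨fun s => s.1 ⟨d n - 1 - k, by omega⟩, fun p => ?_⟩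
    have hk : d n - 1 - (d n - 1 - k) = k := by omega
    simp only [gridMap, cell, hk]
  have h2 : Measurable[approxSigma (μ + ν) fun n => gridMap (h n) (d n)]
      fun p : (ℕ → ℝ) × (ℕ → ℝ) => p.2 := by
    refine @measurable_pi_lambda _ _ _ (_) _ _ fun k => ?_
    refine measurable_approxSigma _ _ hpos h0 ((measurable_pi_apply k).comp measurable_snd) ?_
    filter_upwards [hd.eventually_gt_atTop k] with n hn
    exact ⟨fun s => s.2 ⟨k, hn⟩, fun p => rfl⟩
  intro C hC
  exact (h1.prodMk h2) hC

end Grid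

/-! ### Cell probabilities of blocks of the process -/

section Blocks

variable {Ω : Type*} [mΩ : MeasurableSpace Ω] {P : Measure Ω} {X : ℤ → Ω → ℝ}

/-- The cell of the first block of `d` observations in a window. -/
noncomputable def blockCell (h : ℝ) (d a : ℕ) (v : Fin (2 * d + a + 1) → ℝ) : Fin d → ℤ :=
  cell h fun k => v ⟨1 + k, by omega⟩

/-- The cells of two blocks of `d` observations at lag `a` in a window. -/
noncomputable def pairCell (h : ℝ) (d a : ℕ) (v : Fin (2 * d + a + 1) → ℝ) :
    (Fin d → ℤ) × (Fin d → ℤ) :=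
  (blockCell h d a v, cell h fun k => v ⟨d + a + k, by omega⟩)

lemma measurable_blockCell (h : ℝ) (d a : ℕ) : Measurable (blockCell h d a) :=
  (measurable_cell h).comp (measurable_pi_lambda _ fun _ => measurable_pi_apply _)

lemma measurable_pairCell (h : ℝ) (d a : ℕ) : Measurable (pairCell h d a) :=
  (measurable_blockCell h d a).prodMk
    ((measurable_cell h).comp (measurable_pi_lambda _ fun _ => measurable_pi_apply _))

/-- The probability that the first block falls into a given cell. -/
noncomputable def blockProb (P : Measure Ω) (X : ℤ → Ω → ℝ) (h : ℝ) (d a : ℕ) (t : ℤ)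
    (z : Fin d → ℤ) : ℝ :=
  P.real (window X (2 * d + a) t ⁻¹' (blockCell h d a ⁻¹' {z}))

/-- The probability that two blocks at lag `a` fall into given cells. -/
noncomputable def pairProb (P : Measure Ω) (X : ℤ → Ω → ℝ) (h : ℝ) (d a : ℕ) (t : ℤ)
    (z : (Fin d → ℤ) × (Fin d → ℤ)) : ℝ :=
  P.real (window X (2 * d + a) t ⁻¹' (pairCell h d a ⁻¹' {z}))

lemma hasSum_real_preimage [IsProbabilityMeasure P] {S : Type*} [MeasurableSpace S] [Countable S]
    [MeasurableSingletonClass S] {Y : Ω → S} (hY : Measurable Y) :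
    HasSum (fun z => P.real (Y ⁻¹' {z})) 1 := by
  have := Measure.isProbabilityMeasure_map (μ := P) hY.aemeasurable
  simpa [map_measureReal_apply hY (measurableSet_singleton _)] using
    hasSum_indicator_real (P.map Y) Set.univ

lemma one_sub_sum_real_preimage [IsProbabilityMeasure P] {S : Type*} [MeasurableSpace S]
    [MeasurableSingletonClass S] {Y : Ω → S} (hY : Measurable Y) (B : Finset S) :
    1 - ∑ z ∈ B, P.real (Y ⁻¹' {z}) = P.real {ω | Y ω ∉ B} := by
  have h1 : ∑ z ∈ B, P.real (Y ⁻¹' {z}) = P.real (Y ⁻¹' B) := by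
    rw [← measureReal_biUnion_finset]
    · congr 1
      ext ω
      simp
    · intro b _ b' _ hbb
      exact Set.disjoint_left.2 fun x hx hx' => hbb (hx.symm.trans hx')
    · exact fun b _ => hY (measurableSet_singleton b)
  have h2 := probReal_compl_eq_one_sub (μ := P) (hY B.measurableSet)
  rw [h1, ← h2]
  rfl

/-- Base time `t - d` makes the first block end at `t` and the second start at `t + a`. By
stationarity both blocks have the same cell probabilities, so `blockProb` serves for both factors.
-/
lemma half_tsum_eq_tvDist_gridMap [IsProbabilityMeasure P] (hX : ∀ s, Measurable (X s))
    (hstat : IsStationary P X) (h : ℝ) (d a : ℕ) (t : ℤ) :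
    (1 / 2) * ∑' z : (Fin d → ℤ) × (Fin d → ℤ),
      |blockProb P X h d a (t - d) z.1 * blockProb P X h d a (t - d) z.2 -
        pairProb P X h d a (t - d) z| =
    tvDist (((P.map (past X t)).prod (P.map (future X (t + a)))).map (gridMap h d))
      ((P.map fun ω => (past X t ω, future X (t + a) ω)).map (gridMap h d)) := by
  have hp := measurable_past hX t
  have hf := measurable_future hX (t + a)
  have hg := measurable_gridMap h d
  have := Measure.isProbabilityMeasure_map (μ := P) hp.aemeasurable
  have := Measure.isProbabilityMeasure_map (μ := P) hf.aemeasurable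
  have := Measure.isProbabilityMeasure_map (μ := P) (hp.prodMk hf).aemeasurable
  have := Measure.isProbabilityMeasure_map (μ := P.map fun ω => (past X t ω, future X (t + a) ω))
    hg.aemeasurable
  have := Measure.isProbabilityMeasure_map
    (μ := (P.map (past X t)).prod (P.map (future X (t + a)))) hg.aemeasurable
  rw [← half_tsum_abs_eq_tvDist]
  congr 2
  ext z
  have hzs := measurableSet_singleton z
  have h1 : MeasurableSet {x : ℕ → ℝ | cell h (fun k : Fin d => x (d - 1 - k)) = z.1} :=
    ((measurable_cell h).comp (measurable_pi_lambda _ fun _ => measurable_pi_apply _))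
      (measurableSet_singleton z.1)
  have h2 : MeasurableSet {x : ℕ → ℝ | cell h (fun k : Fin d => x k) = z.2} :=
    ((measurable_cell h).comp (measurable_pi_lambda _ fun _ => measurable_pi_apply _))
      (measurableSet_singleton z.2)
  have hpre : gridMap h d ⁻¹' {z} = {x : ℕ → ℝ | cell h (fun k : Fin d => x (d - 1 - k)) = z.1} ×ˢ
      {x : ℕ → ℝ | cell h (fun k : Fin d => x k) = z.2} := by
    ext p
    simp [gridMap, Prod.ext_iff]
  have hwin : ∀ k : Fin d, ∀ ω, X (t - d + ((1 + k : ℕ) : ℤ)) ω = past X t ω (d - 1 - k) := by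
    intro k ω
    rw [past]
    congr 1
    omega
  have e1 : blockProb P X h d a (t - d) z.1 = P.real
      (past X t ⁻¹' {x : ℕ → ℝ | cell h (fun k : Fin d => x (d - 1 - k)) = z.1}) := by
    rw [blockProb]
    congr 1
    ext ω
    simp only [Set.mem_preimage, Set.mem_singleton_iff, blockCell, window, Set.mem_ofPred_eq, hwin]
  have e2 : blockProb P X h d a (t - d) z.2 = P.real
      (future X (t + a) ⁻¹' {x : ℕ → ℝ | cell h (fun k : Fin d => x k) = z.2}) := by
    rw [blockProb, hstat.real_window_preimage hX _
      (measurable_blockCell h d a (measurableSet_singleton _)) (t - d) (t + a - 1)]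
    congr 1
    ext ω
    have : ∀ k : Fin d, X (t + a - 1 + ((1 + k : ℕ) : ℤ)) ω = future X (t + a) ω k := by
      intro k
      rw [future]
      congr 1
      push_cast
      ring
    simp only [Set.mem_preimage, Set.mem_singleton_iff, blockCell, window, Set.mem_ofPred_eq, this]
  have e3 : pairProb P X h d a (t - d) z = P.real
      ((fun ω => (past X t ω, future X (t + a) ω)) ⁻¹' (gridMap h d ⁻¹' {z})) := by
    rw [pairProb]
    congr 1
    ext ω
    have : ∀ k : Fin d, X (t - d + ((d + a + k : ℕ) : ℤ)) ω = future X (t + a) ω k := by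
      intro k
      rw [future]
      congr 1
      push_cast
      ring
    simp only [Set.mem_preimage, Set.mem_singleton_iff, pairCell, blockCell, window, hwin, this,
      gridMap]
  rw [map_measureReal_apply hg hzs, map_measureReal_apply hg hzs,
    map_measureReal_apply (hp.prodMk hf) (hg hzs), ← e3, hpre, measureReal_prod_prod,
    map_measureReal_apply hp h1, map_measureReal_apply hf h2, ← e1, ← e2]

end Blocks

/-! ### Finite-sample error bound -/

section FiniteSample

variable {Ω : Type*} [mΩ : MeasurableSpace Ω] {P : Measure Ω} {X : ℤ → Ω → ℝ}

/-- The cells that meet the cube `[-R, R]^d`. -/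
noncomputable def cubeCells (h R : ℝ) (d : ℕ) : Finset (Fin d → ℤ) :=
  Fintype.piFinset fun _ => Finset.Icc ⌊-R / h⌋ ⌊R / h⌋

lemma card_cubeCells_le {h R : ℝ} (hh : 0 < h) (hh1 : h ≤ 1) (hR : 0 ≤ R) (d : ℕ) :
    ((cubeCells h R d).card : ℝ) ≤ ((2 * R + 2) / h) ^ d := by
  rw [cubeCells, Fintype.card_piFinset, Finset.prod_const, Finset.card_univ, Fintype.card_fin,
    Nat.cast_pow, Int.card_Icc]
  refine pow_le_pow_left₀ (Nat.cast_nonneg _) ?_ d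
  have hle : ⌊-R / h⌋ ≤ ⌊R / h⌋ := Int.floor_mono (by gcongr; linarith)
  have hc : (((⌊R / h⌋ + 1 - ⌊-R / h⌋).toNat : ℕ) : ℝ) = ⌊R / h⌋ + 1 - ⌊-R / h⌋ := by
    have : (((⌊R / h⌋ + 1 - ⌊-R / h⌋).toNat : ℕ) : ℤ) = ⌊R / h⌋ + 1 - ⌊-R / h⌋ :=
      Int.toNat_of_nonneg (by omega)
    exact_mod_cast this
  rw [hc]
  have h1 := Int.floor_le (R / h)
  have h2 := Int.lt_floor_add_one (-R / h)
  have h3 : 2 ≤ 2 / h := by rw [le_div_iff₀ hh]; linarith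
  have h4 : (2 * R + 2) / h = R / h - -R / h + 2 / h := by ring
  linarith

lemma cell_mem_cubeCells {h R : ℝ} (hh : 0 < h) {d : ℕ} {x : Fin d → ℝ} (hx : ∀ k, |x k| ≤ R) :
    cell h x ∈ cubeCells h R d := by
  refine Fintype.mem_piFinset.2 fun k => Finset.mem_Icc.2 ?_
  have := abs_le.1 (hx k)
  constructor
  · exact Int.floor_mono (by have := this.1; gcongr)
  · exact Int.floor_mono (by have := this.2; gcongr)

lemma IsStationary.real_abs_gt [IsProbabilityMeasure P] (hX : ∀ s, Measurable (X s))
    (hstat : IsStationary P X) (R : ℝ) (s : ℤ) :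
    P.real {ω | R < |X s ω|} = P.real {ω | R < |X 0 ω|} := by
  have hA : MeasurableSet {v : Fin (0 + 1) → ℝ | R < |v 0|} :=
    measurableSet_lt measurable_const (measurable_pi_apply 0).abs
  simpa [window, Set.preimage] using hstat.real_window_preimage hX 0 hA s 0

lemma real_cell_notMem_le [IsProbabilityMeasure P] (hX : ∀ s, Measurable (X s))
    (hstat : IsStationary P X) {h : ℝ} (hh : 0 < h) (R : ℝ) {d : ℕ} (σ : Fin d → ℤ) :
    P.real {ω | cell h (fun k => X (σ k) ω) ∉ cubeCells h R d} ≤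
      d * P.real {ω | R < |X 0 ω|} := by
  have hsub : {ω | cell h (fun k => X (σ k) ω) ∉ cubeCells h R d} ⊆
      ⋃ k : Fin d, {ω | R < |X (σ k) ω|} := by
    intro ω hω
    by_contra hc
    simp only [Set.mem_iUnion, Set.mem_ofPred_eq, not_exists, not_lt] at hc
    exact hω (cell_mem_cubeCells hh hc)
  refine (measureReal_mono hsub).trans ((measureReal_iUnion_fintype_le _).trans ?_)
  simp [hstat.real_abs_gt hX R]

/-- The estimator is, in mean, close to the total variation distance of the binned laws. -/
theorem exists_bound_abs_betaHat_sub [IsProbabilityMeasure P] (hX : ∀ s, Measurable (X s))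
    (hstat : IsStationary P X) {n d a : ℕ} (ha : 1 ≤ a) (hN : n + 2 - (2 * d + a) ≠ 0) {h : ℝ}
    (hh : 0 < h) (hh1 : h ≤ 1) {R : ℝ} (hR : 0 ≤ R) (g : ℕ) (t : ℤ) :
    ∃ G : Ω → ℝ, Integrable G P ∧
      (∀ ω, |betaHat (fun s => X s ω) n d a h -
        tvDist (((P.map (past X t)).prod (P.map (future X (t + a)))).map (gridMap h d))
          ((P.map fun ω => (past X t ω, future X (t + a) ω)).map (gridMap h d))| ≤ G ω) ∧
      ∫ ω, G ω ∂P ≤ 6 * betaCoef P X t g +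
        3 * √(4 * (2 * d + a + g) * ((2 * R + 2) / h) ^ (2 * d) / (n + 2 - (2 * d + a) : ℕ)) +
        4 * (d * P.real {ω | R < |X 0 ω|}) := by
  have hN1 : n + 1 - d ≠ 0 := by omega
  set N₂ := n + 2 - (2 * d + a) with hN₂
  set N₁ := n + 1 - d with hN₁
  have hN12 : N₂ ≤ N₁ := by omega
  set B := cubeCells h R d with hB
  set q := blockProb P X h d a (t - d) with hq
  set Q := pairProb P X h d a (t - d) with hQ
  have hmb := (measurable_blockCell h d a).comp (measurable_window hX (2 * d + a) (t - d))
  have hmp := (measurable_pairCell h d a).comp (measurable_window hX (2 * d + a) (t - d))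
  have hqs : HasSum q 1 := hasSum_real_preimage (P := P) hmb
  have hQs : HasSum Q 1 := hasSum_real_preimage (P := P) hmp
  have hq0 : ∀ z, 0 ≤ q z := fun z => measureReal_nonneg
  have hQ0 : ∀ z, 0 ≤ Q z := fun z => measureReal_nonneg
  obtain ⟨hi1, hc1⟩ := integral_sum_abs_freq_sub_le (P := P) hX hstat
    (measurable_blockCell h d a) B g (t - d) hN1
  obtain ⟨hi2, hc2⟩ := integral_sum_abs_freq_sub_le (P := P) hX hstat
    (measurable_pairCell h d a) (B ×ˢ B) g (t - d) hN
  rw [hstat.betaCoef_eq hX _ t] at hc1 hc2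
  set p := d * P.real {ω | R < |X 0 ω|} with hp
  have hq1 : 1 - ∑ z ∈ B, q z ≤ p :=
    (one_sub_sum_real_preimage (P := P) hmb B).le.trans
      (real_cell_notMem_le hX hstat hh R fun k => t - d + ((1 + k : ℕ) : ℤ))
  have hQ1 : 1 - ∑ z ∈ B ×ˢ B, Q z ≤ 2 * p := by
    refine (one_sub_sum_real_preimage (P := P) hmp (B ×ˢ B)).le.trans ?_
    have hsub : {ω | (pairCell h d a ∘ window X (2 * d + a) (t - d)) ω ∉ B ×ˢ B} ⊆
        {ω | cell h (fun k : Fin d => X (t - d + ((1 + k : ℕ) : ℤ)) ω) ∉ B} ∪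
        {ω | cell h (fun k : Fin d => X (t - d + ((d + a + k : ℕ) : ℤ)) ω) ∉ B} := by
      intro ω hω
      by_contra hc
      simp only [Set.mem_union, Set.mem_ofPred_eq, not_or, not_not] at hc
      exact hω (Finset.mem_product.2 hc)
    refine (measureReal_mono hsub).trans ((measureReal_union_le _ _).trans ?_)
    linarith [real_cell_notMem_le hX hstat hh R fun k : Fin d => t - d + ((1 + k : ℕ) : ℤ),
      real_cell_notMem_le hX hstat hh R fun k : Fin d => t - d + ((d + a + k : ℕ) : ℤ)]
  have hbase : 1 ≤ (2 * R + 2) / h := by rw [le_div_iff₀ hh]; linarith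
  have hcard1 := card_cubeCells_le hh hh1 hR d
  have hcard2 : (((B ×ˢ B).card : ℕ) : ℝ) ≤ ((2 * R + 2) / h) ^ (2 * d) := by
    rw [Finset.card_product, Nat.cast_mul, two_mul d, pow_add]
    gcongr
  -- Deliberately crude: with `N₂ ≤ N₁`, one bound `W` then covers both the block and the pair
  -- frequencies.
  have hcard1' : ((B.card : ℕ) : ℝ) ≤ ((2 * R + 2) / h) ^ (2 * d) :=
    hcard1.trans (pow_le_pow_right₀ hbase (by omega))
  have hN₂0 : (0 : ℝ) < N₂ := by positivity
  set W := √(4 * (2 * d + a + g) * ((2 * R + 2) / h) ^ (2 * d) / N₂) with hW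
  have hs1 : √(4 * (((2 * d + a : ℕ) : ℝ) + g) * B.card / N₁) ≤ W := by
    push_cast
    rw [hW]
    gcongr
  have hs2 : √(4 * (((2 * d + a : ℕ) : ℝ) + g) * (B ×ˢ B).card / N₂) ≤ W := by
    push_cast
    rw [hW]
    gcongr
  let f : Ω → (Fin d → ℤ) → ℝ := fun ω =>
    freq N₁ fun i => blockCell h d a (window X (2 * d + a) i ω)
  let F : Ω → (Fin d → ℤ) × (Fin d → ℤ) → ℝ := fun ω =>
    freq N₂ fun i => pairCell h d a (window X (2 * d + a) i ω)
  -- The pair tail and the block tail contribute `2 * p` each. An integrable majorant spares a proof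
  -- that `betaHat` is measurable.
  refine ⟨fun ω => (∑ z ∈ B ×ˢ B, |F ω z - Q z| + 2 * ∑ z ∈ B, |f ω z - q z|) + 4 * p,
    (hi2.add (hi1.const_mul 2)).add (integrable_const _), fun ω => ?_, ?_⟩
  · have hbh : betaHat (fun s => X s ω) n d a h =
        (1 / 2) * ∑' z : (Fin d → ℤ) × (Fin d → ℤ), |F ω z - f ω z.1 * f ω z.2| := by
      rw [betaHat_eq_tsum _ n d a hh hN1 hN]
      -- The index `i` starts at 0 but the sample at `X 1`, so slot 0 of a window is never read.
      have e1 : ∀ (i : ℕ) (k : Fin d), X (i + 1 + ((k : ℕ) : ℤ)) ω =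
          X (i + ((1 + k : ℕ) : ℤ)) ω := fun i k => by congr 1; push_cast; ring
      have e2 : ∀ (i : ℕ) (k : Fin d), X (i + d + a + ((k : ℕ) : ℤ)) ω =
          X (i + ((d + a + k : ℕ) : ℤ)) ω := fun i k => by congr 1; push_cast; ring
      simp only [e1, e2]
      rfl
    rw [hbh, ← half_tsum_eq_tvDist_gridMap hX hstat]
    refine (abs_half_tsum_sub_half_tsum_le (freq_nonneg _ _) (hasSum_freq hN1 _) hq0 hqs
      (hasSum_freq hN _) hQs).trans ?_
    have h1 := tsum_abs_sub_le_of_finset (freq_nonneg _ _) (hasSum_freq hN1 _) hq0 hqs B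
      (f := f ω)
    have h2 := tsum_abs_sub_le_of_finset (freq_nonneg _ _) (hasSum_freq hN _) hQ0 hQs (B ×ˢ B)
      (f := F ω)
    linarith
  · have hi12 : Integrable (fun ω => ∑ z ∈ B ×ˢ B, |F ω z - Q z| + 2 * ∑ z ∈ B, |f ω z - q z|) P :=
      hi2.add (hi1.const_mul 2)
    have hsplit : ∫ ω, ((∑ z ∈ B ×ˢ B, |F ω z - Q z| + 2 * ∑ z ∈ B, |f ω z - q z|) + 4 * p) ∂P =
        (∫ ω, ∑ z ∈ B ×ˢ B, |F ω z - Q z| ∂P + 2 * ∫ ω, ∑ z ∈ B, |f ω z - q z| ∂P) + 4 * p := by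
      rw [integral_add hi12 (integrable_const _), integral_const, probReal_univ, one_smul]
      congr 1
      rw [← integral_const_mul]
      exact integral_add hi2 (hi1.const_mul 2)
    have hc1' : ∫ ω, ∑ z ∈ B, |f ω z - q z| ∂P ≤ 2 * betaCoef P X t g + W :=
      hc1.trans (by gcongr)
    have hc2' : ∫ ω, ∑ z ∈ B ×ˢ B, |F ω z - Q z| ∂P ≤ 2 * betaCoef P X t g + W :=
      hc2.trans (by gcongr)
    rw [hsplit]
    linarith

end FiniteSample

/-! ### The Lambert function and the growth of the dimension -/

section Lambert

lemma lambertW_mul_exp {x : ℝ} (hx : 0 ≤ x) : lambertW x * Real.exp (lambertW x) = x := by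
  have hex : ∃ w ∈ Set.Ici (-1 : ℝ), w * Real.exp w = x := by
    have hc : ContinuousOn (fun w : ℝ => w * Real.exp w) (Set.Icc 0 x) := by fun_prop
    have hmem : x ∈ Set.Icc (0 * Real.exp 0) (x * Real.exp x) :=
      ⟨by simpa using hx, le_mul_of_one_le_right hx (Real.one_le_exp hx)⟩
    obtain ⟨w, hw, hwx⟩ := intermediate_value_Icc hx hc hmem
    exact ⟨w, by have := hw.1; simp only [Set.mem_Ici]; linarith, hwx⟩
  exact Function.invFunOn_eq hex

lemma tendsto_lambertW : Tendsto lambertW atTop atTop := by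
  refine tendsto_atTop.2 fun M => ?_
  filter_upwards [eventually_gt_atTop (|M| * Real.exp |M|), eventually_ge_atTop 0] with x hx hx0
  by_contra! hlt
  have h := lambertW_mul_exp hx0
  have hM : lambertW x ≤ |M| := hlt.le.trans (le_abs_self M)
  have : lambertW x * Real.exp (lambertW x) ≤ |M| * Real.exp |M| := by
    gcongr
  linarith

lemma tendsto_lambertW_log : Tendsto (fun n : ℕ => lambertW (Real.log n)) atTop atTop :=
  tendsto_lambertW.comp (Real.tendsto_log_atTop.comp tendsto_natCast_atTop_atTop)

lemma exists_le_mul_exp_lambertW {d : ℕ → ℕ}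
    (hdO : (fun n : ℕ => (d n : ℝ)) =O[atTop] fun n : ℕ => Real.exp (lambertW (Real.log n))) :
    ∃ K > 0, ∀ᶠ n : ℕ in atTop, (d n : ℝ) ≤ K * Real.exp (lambertW (Real.log n)) := by
  obtain ⟨K, hK, h⟩ := hdO.exists_pos
  refine ⟨K, hK, h.bound.mono fun n hn => ?_⟩
  simpa using hn

/-- With `w = W(log n)`, `d ≤ K e^w` gives `log d ≤ 2w` eventually, and `w e^w = log n`. Consistency
uses the growth condition only in this form. -/
lemma exists_mul_log_le {d : ℕ → ℕ} (hd : Tendsto d atTop atTop)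
    (hdO : (fun n : ℕ => (d n : ℝ)) =O[atTop] fun n : ℕ => Real.exp (lambertW (Real.log n))) :
    ∃ C > 0, ∀ᶠ n : ℕ in atTop, (d n : ℝ) * Real.log (d n) ≤ C * Real.log n := by
  obtain ⟨K, hK, h⟩ := exists_le_mul_exp_lambertW hdO
  refine ⟨2 * K, by positivity, ?_⟩
  filter_upwards [h, hd.eventually_ge_atTop 1, eventually_ge_atTop 1,
    tendsto_lambertW_log.eventually_ge_atTop (Real.log K),
    tendsto_lambertW_log.eventually_ge_atTop 0] with n hn hd1 hn1 hKw hw0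
  set w := lambertW (Real.log n)
  have hw : w * Real.exp w = Real.log n :=
    lambertW_mul_exp (Real.log_nonneg (by exact_mod_cast hn1))
  have hd1' : (1 : ℝ) ≤ d n := by exact_mod_cast hd1
  have hlog : Real.log (d n) ≤ 2 * w := by
    calc Real.log (d n) ≤ Real.log (K * Real.exp w) := Real.log_le_log (by linarith) hn
      _ = Real.log K + w := by rw [Real.log_mul hK.ne' (Real.exp_pos _).ne', Real.log_exp]
      _ ≤ 2 * w := by linarith
  calc (d n : ℝ) * Real.log (d n) ≤ (K * Real.exp w) * (2 * w) := by
        gcongr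
    _ = 2 * K * (w * Real.exp w) := by ring
    _ = 2 * K * Real.log n := by rw [hw]

lemma exists_isAdmissibleBandwidth {d : ℕ → ℕ}
    (hdO : (fun n : ℕ => (d n : ℝ)) =O[atTop] fun n : ℕ => Real.exp (lambertW (Real.log n))) :
    ∃ h : ℕ → ℝ, IsAdmissibleBandwidth d h := by
  obtain ⟨K, hK, h⟩ := exists_le_mul_exp_lambertW hdO
  -- Since `d n * w ≤ K * log n`, this constant gives `h n ^ (2 * d n) ≥ n ^ (-1/4)`, so `γ = 1/2`
  -- leaves `n ^ (1/4)`.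
  have hδ : 0 < 1 / (8 * K) := by positivity
  refine ⟨fun n => Real.exp (-(1 / (8 * K) * lambertW (Real.log n))), fun n => Real.exp_pos _,
    ?_, 1 / 2, by norm_num, ?_⟩
  · exact Real.tendsto_exp_neg_atTop_nhds_zero.comp (tendsto_lambertW_log.const_mul_atTop hδ)
  · have hlim : Tendsto (fun n : ℕ => (n : ℝ) ^ (1 / 4 : ℝ)) atTop atTop :=
      (tendsto_rpow_atTop (by norm_num)).comp tendsto_natCast_atTop_atTop
    refine tendsto_atTop_mono' _ ?_ hlim
    filter_upwards [h, eventually_ge_atTop 1, tendsto_lambertW_log.eventually_ge_atTop 0]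
      with n hn hn1 hw0
    set w := lambertW (Real.log n)
    have hw : w * Real.exp w = Real.log n :=
      lambertW_mul_exp (Real.log_nonneg (by exact_mod_cast hn1))
    have hn0 : (0 : ℝ) < n := by exact_mod_cast hn1
    rw [← Real.exp_nat_mul, Real.rpow_def_of_pos hn0, Real.rpow_def_of_pos hn0, ← Real.exp_add]
    refine Real.exp_le_exp.2 ?_
    have h1 : (d n : ℝ) * w ≤ K * Real.log n := by
      rw [← hw]
      nlinarith
    have h2 : ((2 * d n : ℕ) : ℝ) * -(1 / (8 * K) * w) = -((d n * w) / K / 4) := by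
      push_cast
      field_simp
      ring
    have h3 : (d n * w) / K ≤ Real.log n := by
      rw [div_le_iff₀ hK]
      linarith
    rw [h2]
    linarith

end Lambert

/-! ### Asymptotics of tail and variance terms -/

section Asymptotics

/-- Markov's inequality with a moment of order `p ≥ 2 / ε` bounds the probability by a constant over
`d ^ 2`, which beats the factor `d`. -/
lemma tendsto_mul_real_abs_gt {Ω : Type*} [MeasurableSpace Ω] {P : Measure Ω}
    [IsProbabilityMeasure P] {Y : Ω → ℝ} (hmom : ∀ p : ℕ, Integrable (fun ω => |Y ω| ^ p) P)
    {d : ℕ → ℕ} (hd : Tendsto d atTop atTop) {ε : ℝ} (hε : 0 < ε) :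
    Tendsto (fun n => (d n : ℝ) * P.real {ω | (d n : ℝ) ^ ε < |Y ω|}) atTop (𝓝 0) := by
  obtain ⟨p, hp⟩ := exists_nat_ge (2 / ε)
  have hp2 : 2 ≤ ε * p := by rwa [div_le_iff₀ hε, mul_comm] at hp
  set M := ∫ ω, |Y ω| ^ p ∂P with hM
  have hdR : Tendsto (fun n => (d n : ℝ)) atTop atTop := tendsto_natCast_atTop_atTop.comp hd
  refine squeeze_zero' (Eventually.of_forall fun n => by positivity) ?_
    (hdR.const_div_atTop M)
  filter_upwards [hd.eventually_ge_atTop 1] with n hn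
  have hd1 : (1 : ℝ) ≤ d n := by exact_mod_cast hn
  have hmk := mul_meas_ge_le_integral_of_nonneg (μ := P)
    (Eventually.of_forall fun ω => by positivity) (hmom p) ((d n : ℝ) ^ 2)
  have hsub : {ω | (d n : ℝ) ^ ε < |Y ω|} ⊆ {ω | (d n : ℝ) ^ 2 ≤ |Y ω| ^ p} := by
    intro ω hω
    have hω' : (d n : ℝ) ^ ε < |Y ω| := hω
    calc (d n : ℝ) ^ 2 = (d n : ℝ) ^ (2 : ℝ) := by norm_cast
      _ ≤ (d n : ℝ) ^ (ε * p) := Real.rpow_le_rpow_of_exponent_le hd1 hp2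
      _ = ((d n : ℝ) ^ ε) ^ p := by rw [Real.rpow_mul (by linarith), Real.rpow_natCast]
      _ ≤ |Y ω| ^ p := pow_le_pow_left₀ (by positivity) hω'.le p
  have hle : P.real {ω | (d n : ℝ) ^ ε < |Y ω|} ≤ P.real {ω | (d n : ℝ) ^ 2 ≤ |Y ω| ^ p} :=
    measureReal_mono hsub
  rw [le_div_iff₀ (by linarith)]
  nlinarith [sq_nonneg (d n : ℝ)]

lemma eventually_mul_log_add_le_rpow (C c : ℝ) {δ : ℝ} (hδ : 0 < δ) :
    ∀ᶠ n : ℕ in atTop, C * Real.log n + c ≤ (n : ℝ) ^ δ := by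
  have h1 : (fun x : ℝ => C * Real.log x + c) =o[atTop] fun x : ℝ => x ^ δ :=
    ((isLittleO_log_rpow_atTop hδ).const_mul_left C).add
      (isLittleO_const_left.2 (Or.inr (tendsto_norm_atTop_atTop.comp (tendsto_rpow_atTop hδ))))
  have h2 := (h1.bound one_pos).natCast_atTop
  filter_upwards [h2] with n hn
  rw [one_mul, Real.norm_of_nonneg (Real.rpow_nonneg (Nat.cast_nonneg n) δ)] at hn
  exact (le_abs_self _).trans hn

lemma eventually_le_mul_log {d : ℕ → ℕ} (hd : Tendsto d atTop atTop) {C : ℝ}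
    (hdC : ∀ᶠ n : ℕ in atTop, (d n : ℝ) * Real.log (d n) ≤ C * Real.log n) :
    ∀ᶠ n : ℕ in atTop, (d n : ℝ) ≤ C * Real.log n := by
  have hdR : Tendsto (fun n => (d n : ℝ)) atTop atTop := tendsto_natCast_atTop_atTop.comp hd
  filter_upwards [hdC, hdR.eventually_ge_atTop (Real.exp 1)] with n h1 h2
  have h3 : 1 ≤ Real.log (d n) := by
    rw [Real.le_log_iff_exp_le ((Real.exp_pos 1).trans_le h2)]
    exact h2
  nlinarith [Nat.cast_nonneg (α := ℝ) (d n)]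

lemma eventually_sample_size_ge {d : ℕ → ℕ} {C : ℝ} (hdlog : ∀ᶠ n : ℕ in atTop,
    (d n : ℝ) ≤ C * Real.log n) (a : ℕ) :
    ∀ᶠ n : ℕ in atTop, (n : ℝ) / 2 ≤ (n + 2 - (2 * d n + a) : ℕ) := by
  filter_upwards [hdlog, eventually_mul_log_add_le_rpow (4 * C) (2 * a) one_pos] with n h1 h2
  rw [Real.rpow_one] at h2
  have h3 : 2 * (2 * (d n : ℝ) + a) ≤ n := by linarith
  have h4 : 2 * (2 * d n + a) ≤ n := by exact_mod_cast h3
  have h5 : n ≤ 2 * (n + 2 - (2 * d n + a)) := by omega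
  have h6 : (n : ℝ) ≤ 2 * (n + 2 - (2 * d n + a) : ℕ) := by exact_mod_cast h5
  linarith

/-- The linear factor and the truncation cube cost at most `n ^ ((1 - γ) / 4)` each, the bandwidth
at most `n ^ γ`, and the sample size is at least `n / 2`. The exponents add up to `-(1 - γ) / 2`. -/
lemma tendsto_variance_bound {d : ℕ → ℕ} (hd : Tendsto d atTop atTop) {h : ℕ → ℝ}
    (hpos : ∀ n, 0 < h n) {γ : ℝ} (hγ : γ < 1)
    (hbin : Tendsto (fun n : ℕ => (n : ℝ) ^ γ * h n ^ (2 * d n)) atTop atTop) {C : ℝ} (hC : 0 < C)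
    (hdC : ∀ᶠ n : ℕ in atTop, (d n : ℝ) * Real.log (d n) ≤ C * Real.log n) (a g : ℕ) :
    Tendsto (fun n => 4 * (2 * d n + a + g) *
      ((2 * (d n : ℝ) ^ ((1 - γ) / (16 * C)) + 2) / h n) ^ (2 * d n) /
        (n + 2 - (2 * d n + a) : ℕ)) atTop (𝓝 0) := by
  set ε := (1 - γ) / (16 * C) with hε
  have hγ' : 0 < 1 - γ := by linarith
  have hε0 : 0 < ε := by positivity
  have hdR : Tendsto (fun n => (d n : ℝ)) atTop atTop := tendsto_natCast_atTop_atTop.comp hd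
  have hdlog := eventually_le_mul_log hd hdC
  have hlim : Tendsto (fun n : ℕ => 2 * (n : ℝ) ^ (-((1 - γ) / 2))) atTop (𝓝 0) := by
    simpa using ((tendsto_rpow_neg_atTop (show 0 < (1 - γ) / 2 by positivity)).comp
      tendsto_natCast_atTop_atTop).const_mul 2
  refine squeeze_zero' (Eventually.of_forall fun n => ?_) ?_ hlim
  · have := hpos n
    positivity
  filter_upwards [hdC, hdlog, eventually_sample_size_ge hdlog a, eventually_ge_atTop 1,
    hbin.eventually_ge_atTop 1, hd.eventually_ge_atTop 1,
    ((tendsto_rpow_atTop hε0).comp hdR).eventually_ge_atTop 4,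
    eventually_mul_log_add_le_rpow (8 * C) (4 * (a + g)) (show 0 < (1 - γ) / 4 by positivity)]
    with n h1 h2 h3 hn1 h4 hd1 h5 h6
  have hh := hpos n
  have hn0 : (0 : ℝ) < n := by exact_mod_cast hn1
  have hd0 : (0 : ℝ) < d n := by exact_mod_cast hd1
  have hfac : 4 * (2 * (d n : ℝ) + a + g) ≤ (n : ℝ) ^ ((1 - γ) / 4) := by linarith
  -- For `R ≥ 4`, `2R + 2 ≤ R²`, so the exponent is `4ε · d log d ≤ 4εC · log n`; the choice of `ε`
  -- makes `4εC = (1 - γ) / 4`.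
  have hcube : (2 * (d n : ℝ) ^ ε + 2) ^ (2 * d n) ≤ (n : ℝ) ^ ((1 - γ) / 4) := by
    have h7 : 4 ≤ (d n : ℝ) ^ ε := h5
    calc (2 * (d n : ℝ) ^ ε + 2) ^ (2 * d n) ≤ ((d n : ℝ) ^ ε * (d n : ℝ) ^ ε) ^ (2 * d n) := by
          gcongr
          nlinarith
      _ = Real.exp (4 * ε * (d n * Real.log (d n))) := by
          rw [Real.rpow_def_of_pos hd0, ← Real.exp_add, ← Real.exp_nat_mul]
          congr 1
          push_cast
          ring
      _ ≤ Real.exp (4 * ε * (C * Real.log n)) := by gcongr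
      _ = (n : ℝ) ^ ((1 - γ) / 4) := by
          rw [Real.rpow_def_of_pos hn0, hε]
          congr 1
          field_simp
          ring
  have hwidth : (h n ^ (2 * d n))⁻¹ ≤ (n : ℝ) ^ γ := by
    rw [inv_le_iff_one_le_mul₀ (by positivity)]
    exact h4
  calc 4 * (2 * d n + a + g) * ((2 * (d n : ℝ) ^ ε + 2) / h n) ^ (2 * d n) /
        (n + 2 - (2 * d n + a) : ℕ)
      = 4 * (2 * d n + a + g) * ((2 * (d n : ℝ) ^ ε + 2) ^ (2 * d n) * (h n ^ (2 * d n))⁻¹) /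
        (n + 2 - (2 * d n + a) : ℕ) := by rw [div_pow, div_eq_mul_inv (_ ^ _)]
    _ ≤ (n : ℝ) ^ ((1 - γ) / 4) * ((n : ℝ) ^ ((1 - γ) / 4) * (n : ℝ) ^ γ) / (n / 2) := by
        gcongr
    _ = 2 * ((n : ℝ) ^ ((1 - γ) / 4) * ((n : ℝ) ^ ((1 - γ) / 4) * (n : ℝ) ^ γ) *
          (n : ℝ) ^ (-1 : ℝ)) := by
        rw [Real.rpow_neg_one]
        field_simp
    _ = 2 * (n : ℝ) ^ (-((1 - γ) / 2)) := by
        rw [← Real.rpow_add hn0, ← Real.rpow_add hn0, ← Real.rpow_add hn0]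
        congr 2
        ring

end Asymptotics

end BetaMixing

/-! ### Existence of bandwidths and consistency -/

theorem theorem1 {Ω : Type*} [MeasurableSpace Ω] (P : Measure Ω) [IsProbabilityMeasure P]
    (X : ℤ → Ω → ℝ) (hX : ∀ s, Measurable (X s))
    (hstat : BetaMixing.IsStationary P X) (hmix : BetaMixing.IsBetaMixing P X)
    (hmom : ∀ p : ℕ, Integrable (fun ω => |X 0 ω| ^ p) P)
    (a : ℕ) (ha : 1 ≤ a)
    (d : ℕ → ℕ) (hd : Tendsto d atTop atTop)
    (hdO : (fun n : ℕ => (d n : ℝ)) =O[atTop]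
      fun n : ℕ => Real.exp (BetaMixing.lambertW (Real.log n))) :
    (∃ h : ℕ → ℝ, BetaMixing.IsAdmissibleBandwidth d h) ∧
      ∀ h : ℕ → ℝ, BetaMixing.IsAdmissibleBandwidth d h →
        ∀ t : ℤ, TendstoInMeasure P
          (fun n ω => BetaMixing.betaHat (fun s => X s ω) n (d n) a (h n)) atTop
          (fun _ => BetaMixing.betaCoef P X t a) := by
  refine ⟨BetaMixing.exists_isAdmissibleBandwidth hdO, fun h hh t => ?_⟩
  obtain ⟨hpos, h0, γ, hγ, hbin⟩ := hh
  obtain ⟨C, hC, hdC⟩ := BetaMixing.exists_mul_log_le hd hdO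
  have hε0 : 0 < (1 - γ) / (16 * C) := div_pos (by linarith) (by positivity)
  have hp := BetaMixing.measurable_past hX t
  have hf := BetaMixing.measurable_future hX (t + a)
  have := Measure.isProbabilityMeasure_map (μ := P) hp.aemeasurable
  have := Measure.isProbabilityMeasure_map (μ := P) hf.aemeasurable
  have := Measure.isProbabilityMeasure_map (μ := P) (hp.prodMk hf).aemeasurable
  have hbias := BetaMixing.tendsto_tvDist_gridMap
    ((P.map (BetaMixing.past X t)).prod (P.map (BetaMixing.future X (t + a))))
    (P.map fun ω => (BetaMixing.past X t ω, BetaMixing.future X (t + a) ω)) hd hpos h0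
  change Tendsto _ _ (𝓝 (BetaMixing.betaCoef P X t a)) at hbias
  have htail := (BetaMixing.tendsto_mul_real_abs_gt hmom hd hε0).const_mul 4
  rw [mul_zero] at htail
  rw [tendstoInMeasure_iff_measureReal_norm]
  intro ε hε
  refine tendsto_order.2 ⟨fun r hr => Eventually.of_forall fun n => hr.trans_le measureReal_nonneg,
    fun r hr => ?_⟩
  -- Mixing, variance and tail terms below `r * ε / 6` each give a mean below `r * ε / 2`, as
  -- Markov's inequality at level `ε / 2` requires; the bias takes the other `ε / 2`.
  have hη : 0 < r * ε / 6 := by positivity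
  have hβ := (hmix t).const_mul 6
  rw [mul_zero] at hβ
  -- The gap is chosen before `n` and stays fixed, so mixing without a rate suffices.
  obtain ⟨g, hg⟩ := (hβ.eventually (gt_mem_nhds hη)).exists
  have hvar := ((BetaMixing.tendsto_variance_bound hd hpos hγ hbin hC hdC a g).sqrt).const_mul 3
  rw [Real.sqrt_zero, mul_zero] at hvar
  have hN : ∀ᶠ n : ℕ in atTop, n + 2 - (2 * d n + a) ≠ 0 := by
    have hdlog := BetaMixing.eventually_le_mul_log hd hdC
    filter_upwards [BetaMixing.eventually_sample_size_ge hdlog a, eventually_gt_atTop 0]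
      with n h1 h2 h3
    rw [h3, Nat.cast_zero] at h1
    have : (0 : ℝ) < n := by exact_mod_cast h2
    linarith
  filter_upwards [hN, h0.eventually (gt_mem_nhds one_pos), htail.eventually (gt_mem_nhds hη),
    hvar.eventually (gt_mem_nhds hη),
    hbias.eventually (Metric.ball_mem_nhds _ (half_pos hε))] with n hN hh1 hn1 hn2 hn3
  obtain ⟨G, hGi, hG, hGint⟩ := BetaMixing.exists_bound_abs_betaHat_sub (P := P) hX hstat ha hN
    (hpos n) hh1.le (R := (d n : ℝ) ^ ((1 - γ) / (16 * C))) (by positivity) g t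
  have hsub : {ω | ε ≤ ‖BetaMixing.betaHat (fun s => X s ω) n (d n) a (h n) -
      BetaMixing.betaCoef P X t a‖} ⊆ {ω | ε / 2 ≤ G ω} := by
    intro ω hω
    have h1 : ε ≤ |BetaMixing.betaHat (fun s => X s ω) n (d n) a (h n) -
      BetaMixing.betaCoef P X t a| := hω
    rw [Real.dist_eq] at hn3
    have h2 := abs_sub_le (BetaMixing.betaHat (fun s => X s ω) n (d n) a (h n)) _
      (BetaMixing.betaCoef P X t a) |>.trans (add_le_add (hG ω) hn3.le)
    change ε / 2 ≤ G ω
    linarith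
  have hmk := mul_meas_ge_le_integral_of_nonneg (μ := P)
    (Eventually.of_forall fun ω => (abs_nonneg _).trans (hG ω)) hGi (ε / 2)
  have hmono := measureReal_mono (μ := P) hsub
  refine hmono.trans_lt ?_
  have hlt : ε / 2 * P.real {ω | ε / 2 ≤ G ω} < ε / 2 * r := by linarith
  exact lt_of_mul_lt_mul_left hlt (by positivity)
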